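/- Let $n\ge 1$, $\gamma\in[1,2)$, and let $u_0\in H^1(\mathbb{R}^n)\cap L^\gamma(\mathbb{R}^n)$ with $u_0\ge 0$ a.e. Let $Q=\mathbb{R}^n\times(0,\infty)$ and, for $r>0$, $Q_r^+=B_r\times(0,r^2)$, where $B_r\subset\mathbb{R}^n$ is the ball of radius $r$ centred at the origin. Let $\mathcal{U}=\bigcap_{r>0}H^1(Q_r^+)$ and $\mathcal{U}_0=\{u\in\mathcal{U}: u|_{t=0}=u_0 \text{ in the sense of traces}\}$. For $\varepsilon\in(0,1)$ and $w\in\mathcal{U}$ let $$\mathcal{E}_\varepsilon(w)=\int_0^\infty\frac{e^{-t/\varepsilon}}{\varepsilon}\left(\int_{\mathbb{R}^n}\varepsilon|\partial_t w|^2+|\nabla w|^2\,dx+2\int_{\mathbb{R}^n}w_+^\gamma\,dx\right)dt\in[0,+\infty],$$ where $\nabla$ is the gradient in $x$ and $w_+=\max(w,0)$. **Energy estimates.** There exists a constant $C>0$, depending only on $n$, $\gamma$ and $u_0$, such that for every $\varepsilon\in(0,1)$ and every minimizer $u_\varepsilon$ of $\mathcal{E}_\varepsilon$ in $\mathcal{U}_0$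 we have $$\int_0^\infty\int_{\mathbb{R}^n}|\partial_t u_\varepsilon|^2\,dx\,d\tau\le C$$ and, for every $r\ge\varepsilon$, $$\int_0^r\int_{\mathbb{R}^n}\left(|\nabla u_\varepsilon|^2+2(u_\varepsilon)_+^\gamma\right)dx\,d\tau\le C r.$$ -/

import Mathlib

open Set MeasureTheory
open scoped ContDiff ENNReal

noncomputable section

namespace EllipticReg

section Sobolev

variable {V : Type*} [NormedAddCommGroup V] [NormedSpace ℝ V] [MeasureSpace V]

/-- The locally integrable function `g` is the weak derivative of the locally integrable function
`u` in the direction `v` on the set `Ω` (meant to be open): integration by parts against every test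
function in `C_c^∞(Ω)`. -/
structure IsWeakDeriv (Ω : Set V) (u g : V → ℝ) (v : V) : Prop where
  locallyIntegrableOn_left : LocallyIntegrableOn u Ω volume
  locallyIntegrableOn_right : LocallyIntegrableOn g Ω volume
  integral_eq : ∀ φ : V → ℝ, ContDiff ℝ ∞ φ → HasCompactSupport φ → tsupport φ ⊆ Ω →
    ∫ z in Ω, u z * fderiv ℝ φ z v = - ∫ z in Ω, g z * φ z

/-- `u ∈ H¹(Ω)`: `u ∈ L²(Ω)`, and `u` has weak derivatives in `L²(Ω)` in all directions
(equivalently, in the coordinate directions). -/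
def MemH1 (Ω : Set V) (u : V → ℝ) : Prop :=
  MemLp u 2 (volume.restrict Ω) ∧
    ∀ v : V, ∃ g : V → ℝ, MemLp g 2 (volume.restrict Ω) ∧ IsWeakDeriv Ω u g v

open Classical in
/-- The weak derivative of `u` on `Ω` in the direction `v`, well defined up to null sets
(see `IsWeakDeriv.ae_eq_weakDeriv`); it is `0` by convention if there is none. -/
def weakDeriv (Ω : Set V) (u : V → ℝ) (v : V) : V → ℝ :=
  if h : ∃ g, IsWeakDeriv Ω u g v then h.choose else 0

theorem IsWeakDeriv.weakDeriv {Ω : Set V} {u g : V → ℝ} {v : V} (h : IsWeakDeriv Ω u g v) :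
    IsWeakDeriv Ω u (weakDeriv Ω u v) v := by
  have h' : ∃ g, IsWeakDeriv Ω u g v := ⟨g, h⟩
  rw [EllipticReg.weakDeriv, dif_pos h']
  exact h'.choose_spec

/-- Weak derivatives are unique up to null sets. -/
theorem IsWeakDeriv.ae_eq_weakDeriv [FiniteDimensional ℝ V] [BorelSpace V]
    {Ω : Set V} (hΩ : IsOpen Ω) {u g : V → ℝ} {v : V} (h : IsWeakDeriv Ω u g v) :
    ∀ᵐ z ∂(volume : Measure V), z ∈ Ω → g z = EllipticReg.weakDeriv Ω u v z := by
  have hk := h.weakDeriv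
  set k := EllipticReg.weakDeriv Ω u v
  have hloc : LocallyIntegrableOn (g - k) Ω volume :=
    h.locallyIntegrableOn_right.sub hk.locallyIntegrableOn_right
  have key := hΩ.ae_eq_zero_of_integral_contDiff_smul_eq_zero hloc (fun φ hφ hc hs => by
    have hint : ∀ f : V → ℝ, LocallyIntegrableOn f Ω volume →
        IntegrableOn (fun z => f z * φ z) Ω volume := by
      intro f hf
      have h1 : IntegrableOn f (tsupport φ) volume := hf.integrableOn_compact_subset hs hc
      have h2 : IntegrableOn (fun z => f z * φ z) (tsupport φ) volume :=
        h1.mul_continuousOn hφ.continuous.continuousOn hc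
      have h3 : Integrable (fun z => f z * φ z) volume :=
        (integrableOn_iff_integrable_of_support_subset (fun z hz => by
          apply subset_tsupport
          intro h0
          exact hz (by simp [h0]))).1 h2
      exact h3.integrableOn
    have e1 := h.integral_eq φ hφ hc hs
    have e2 := hk.integral_eq φ hφ hc hs
    have e3 : ∫ z in Ω, (g z * φ z - k z * φ z) = 0 := by
      rw [integral_sub (hint g h.locallyIntegrableOn_right) (hint k hk.locallyIntegrableOn_right)]
      linarith
    rw [← e3, ← setIntegral_eq_integral_of_forall_compl_eq_zero (s := Ω)]
    · refine integral_congr_ae (Filter.Eventually.of_forall fun z => ?_)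
      simp only [Pi.sub_apply, smul_eq_mul]
      ring
    · intro z hz
      rw [image_eq_zero_of_notMem_tsupport (fun h0 => hz (hs h0)), zero_smul])
  filter_upwards [key] with z hz hzΩ
  exact sub_eq_zero.1 (hz hzΩ)

end Sobolev

/-- Points of space-time `ℝⁿ × ℝ`, written `(x, t)`. -/
abbrev SpaceTime (n : ℕ) : Type := EuclideanSpace ℝ (Fin n) × ℝ

/-- `Q = ℝⁿ × (0, ∞)`. -/
def Q (n : ℕ) : Set (SpaceTime n) := univ ×ˢ Ioi 0

/-- `Q_r⁺ = B_r × (0, r²)`. -/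
def Qr (n : ℕ) (r : ℝ) : Set (SpaceTime n) := Metric.ball 0 r ×ˢ Ioo 0 (r ^ 2)

/-- `u ∈ 𝓤 = ⋂_{r > 0} H¹(Q_r⁺)`. -/
def MemU (n : ℕ) (u : SpaceTime n → ℝ) : Prop :=
  ∀ r : ℝ, 0 < r → MemH1 (Qr n r) u

/-- The weak time derivative `∂ₜu` on `Q`. -/
def dt {n : ℕ} (u : SpaceTime n → ℝ) : SpaceTime n → ℝ :=
  weakDeriv (Q n) u (0, 1)

/-- The weak space derivative `∂ᵢu` on `Q`. -/
def dx {n : ℕ} (i : Fin n) (u : SpaceTime n → ℝ) : SpaceTime n → ℝ :=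
  weakDeriv (Q n) u (EuclideanSpace.single i 1, 0)

/-- `|∇u|²`, where `∇` is the weak gradient in the space variables. -/
def gradSq {n : ℕ} (u : SpaceTime n → ℝ) (z : SpaceTime n) : ℝ := ∑ i, dx i u z ^ 2

/-- `u|_{t=0} = u₀` in the sense of traces, for `u ∈ 𝓤`: the Gauss-Green formula
`∫_Q u ∂ₜφ = - ∫_Q ∂ₜu φ - ∫_{ℝⁿ} u₀ φ(·, 0)` for all `φ ∈ C_c^∞(ℝⁿ × ℝ)`
(no condition on `φ` at `t = 0`), which determines the trace `u₀` up to null sets. -/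
def HasInitialTrace {n : ℕ} (u : SpaceTime n → ℝ) (u₀ : EuclideanSpace ℝ (Fin n) → ℝ) : Prop :=
  ∀ φ : SpaceTime n → ℝ, ContDiff ℝ ∞ φ → HasCompactSupport φ →
    ∫ z in Q n, u z * fderiv ℝ φ z (0, 1)
      = - (∫ z in Q n, dt u z * φ z) - ∫ x, u₀ x * φ (x, 0)

/-- `u ∈ 𝓤₀ = {u ∈ 𝓤 : u|_{t=0} = u₀}`. -/
def MemU0 {n : ℕ} (u₀ : EuclideanSpace ℝ (Fin n) → ℝ) (u : SpaceTime n → ℝ) : Prop :=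
  MemU n u ∧ HasInitialTrace u u₀

/-- The functional
`𝓔_ε(w) = ∫₀^∞ (e^{-t/ε}/ε) (∫ ε|∂ₜw|² + |∇w|² dx + 2 ∫ w₊^γ dx) dt ∈ [0, ∞]`. -/
def energy {n : ℕ} (γ ε : ℝ) (w : SpaceTime n → ℝ) : ℝ≥0∞ :=
  ∫⁻ t in Ioi (0 : ℝ), ENNReal.ofReal (Real.exp (-t / ε) / ε) *
    ((∫⁻ x, ENNReal.ofReal (ε * dt w (x, t) ^ 2 + gradSq w (x, t)))
      + 2 * ∫⁻ x, ENNReal.ofReal (max (w (x, t)) 0 ^ γ))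

/-- `u` is an (absolute) minimizer of `𝓔_ε` in `𝓤₀`. -/
def IsMinimizer {n : ℕ} (γ ε : ℝ) (u₀ : EuclideanSpace ℝ (Fin n) → ℝ)
    (u : SpaceTime n → ℝ) : Prop :=
  MemU0 u₀ u ∧ ∀ w, MemU0 u₀ w → energy γ ε u ≤ energy γ ε w

end EllipticReg

end

open EllipticReg

/-!
The estimates come from inner variations in time. Write `k(s) = e^{-s/ε}/ε`, and let `a(s)` be the
kinetic energy `ε ∫ |∂ₜu|² dx` and `ρ(s)` the potential energy `∫ |∇u|² + 2 u₊^γ dx` of a minimizer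
`u` at time `s`. For a smooth reparametrization `ψ` of `[0, ∞)` the function `u(x, ψ⁻¹(t))` has the
same initial trace, so it is a competitor, and the substitution `t = ψ(s)` gives its energy as
`∫ k(ψ(s)) (a(s)/ψ'(s) + ψ'(s) ρ(s)) ds` (`TimeChange.memU0_reparam`, `energy_reparam`). With
`ψ(s) = s + δ ∫₀ˢ η` for a test function `η` on `(0, ∞)`, the derivative at `δ = 0` vanishes
(`integral_firstVariation_eq_zero`). By Fubini and the fundamental lemma of the calculus of
variations, `ρ - a = H` almost everywhere, where
`H(s) = e^{s/ε} ∫_s^∞ k (a + ρ)` (`ae_potential_sub_kinetic_eq`).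

Since `H' = (H - a - ρ)/ε = -2a/ε`, the function `H` is nonincreasing and
`(2/ε) ∫₀^T a + H(T) = H(0)` (`energy_balance`). Here `H(0)` is the minimal energy, at most the
energy of the competitor `u₀` extended constantly in time, which is finite and independent of `ε`
(`memU0_comp_fst`, `energy_comp_fst`). This bounds `∫∫ |∂ₜu|²`, and `ρ = a + H ≤ a + H(0)` gives
`∫₀^r ρ ≤ (ε/2 + r) H(0)`, which is at most `(3/2) H(0) r` when `r ≥ ε`.

The function `dt u` is a weak derivative on all of `Q`, while membership in `𝓤` only gives weak
derivatives on each `Q_r⁺`; these are glued in `exists_isWeakDeriv_iUnion`. The substitution moves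
the smooth map `ψ` onto the test function, so that no smoothness of `ψ⁻¹` is needed.
-/

namespace EllipticReg

/-! ### Weak derivatives: restriction, linearity and gluing -/

section WeakDeriv

variable {V : Type*} [NormedAddCommGroup V] [MeasureSpace V]

theorem setIntegral_mul_eq_integral {Ω : Set V} {θ : V → ℝ} (hs : tsupport θ ⊆ Ω) (f : V → ℝ) :
    ∫ z in Ω, f z * θ z = ∫ z, f z * θ z :=
  setIntegral_eq_integral_of_forall_compl_eq_zero fun z hz => by
    rw [image_eq_zero_of_notMem_tsupport fun h0 => hz (hs h0), mul_zero]

theorem locallyIntegrableOn_congr {Ω : Set V} [OpensMeasurableSpace V] (hΩ : IsOpen Ω)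
    {f g : V → ℝ} (hf : LocallyIntegrableOn f Ω volume) (hfg : ∀ᵐ z, z ∈ Ω → f z = g z) :
    LocallyIntegrableOn g Ω volume := by
  intro x hx
  obtain ⟨s, hs, hi⟩ := hf x hx
  refine ⟨s ∩ Ω, Filter.inter_mem hs self_mem_nhdsWithin, ?_⟩
  have h1 : IntegrableOn f (s ∩ Ω) volume := hi.mono_set inter_subset_left
  refine Integrable.congr h1 ?_
  exact ae_restrict_of_ae_restrict_of_subset inter_subset_right
    ((ae_restrict_iff' hΩ.measurableSet).2 hfg)

theorem integrableOn_mul_test {Ω : Set V} [OpensMeasurableSpace V]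
    {f θ : V → ℝ}
    (hf : LocallyIntegrableOn f Ω volume) (hθ : Continuous θ) (hc : HasCompactSupport θ)
    (hs : tsupport θ ⊆ Ω) : IntegrableOn (fun z => f z * θ z) Ω volume := by
  have h1 : IntegrableOn f (tsupport θ) volume := hf.integrableOn_compact_subset hs hc
  have h2 : IntegrableOn (fun z => f z * θ z) (tsupport θ) volume :=
    h1.mul_continuousOn hθ.continuousOn hc
  refine ((integrableOn_iff_integrable_of_support_subset fun z hz => ?_).1 h2).integrableOn
  by_contra h0
  exact hz (by simp [image_eq_zero_of_notMem_tsupport h0])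

variable [NormedSpace ℝ V]

theorem setIntegral_mul_fderiv_eq_integral {Ω : Set V} {θ : V → ℝ} (hs : tsupport θ ⊆ Ω)
    (f : V → ℝ) (v : V) :
    ∫ z in Ω, f z * fderiv ℝ θ z v = ∫ z, f z * fderiv ℝ θ z v :=
  setIntegral_eq_integral_of_forall_compl_eq_zero fun z hz => by
    have h0 : fderiv ℝ θ z = 0 :=
      image_eq_zero_of_notMem_tsupport fun h0 => hz (hs (tsupport_fderiv_subset ℝ h0))
    rw [h0, zero_apply, mul_zero]

theorem IsWeakDeriv.mono {Ω Ω' : Set V} {u g : V → ℝ} {v : V} (h : IsWeakDeriv Ω u g v)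
    (hΩ : Ω' ⊆ Ω) : IsWeakDeriv Ω' u g v where
  locallyIntegrableOn_left := h.locallyIntegrableOn_left.mono_set hΩ
  locallyIntegrableOn_right := h.locallyIntegrableOn_right.mono_set hΩ
  integral_eq θ hθ hc hs := by
    have := h.integral_eq θ hθ hc (hs.trans hΩ)
    rwa [setIntegral_mul_fderiv_eq_integral hs, setIntegral_mul_eq_integral hs,
      ← setIntegral_mul_fderiv_eq_integral (hs.trans hΩ),
      ← setIntegral_mul_eq_integral (hs.trans hΩ)]

theorem IsWeakDeriv.congr_right {Ω : Set V} [OpensMeasurableSpace V] (hΩ : IsOpen Ω)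
    {u g k : V → ℝ} {v : V} (h : IsWeakDeriv Ω u g v) (hgk : ∀ᵐ z, z ∈ Ω → g z = k z) :
    IsWeakDeriv Ω u k v where
  locallyIntegrableOn_left := h.locallyIntegrableOn_left
  locallyIntegrableOn_right := locallyIntegrableOn_congr hΩ h.locallyIntegrableOn_right hgk
  integral_eq θ hθ hc hs := by
    rw [h.integral_eq θ hθ hc hs]
    congr 1
    refine setIntegral_congr_ae hΩ.measurableSet ?_
    filter_upwards [hgk] with z hz hzΩ
    rw [hz hzΩ]

theorem IsWeakDeriv.add {Ω : Set V} [OpensMeasurableSpace V] {u g k : V → ℝ} {v w : V}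
    (hg : IsWeakDeriv Ω u g v) (hk : IsWeakDeriv Ω u k w) :
    IsWeakDeriv Ω u (g + k) (v + w) where
  locallyIntegrableOn_left := hg.locallyIntegrableOn_left
  locallyIntegrableOn_right := hg.locallyIntegrableOn_right.add hk.locallyIntegrableOn_right
  integral_eq θ hθ hc hs := by
    have hd : ∀ v : V, IntegrableOn (fun z => u z * fderiv ℝ θ z v) Ω volume := fun v =>
      integrableOn_mul_test hg.locallyIntegrableOn_left
        ((hθ.continuous_fderiv (by simp)).clm_apply continuous_const)
        (hc.fderiv_apply ℝ v) ((tsupport_fderiv_apply_subset ℝ v).trans hs)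
    have hm : ∀ f : V → ℝ, LocallyIntegrableOn f Ω volume →
        IntegrableOn (fun z => f z * θ z) Ω volume := fun f hf =>
      integrableOn_mul_test hf hθ.continuous hc hs
    simp only [map_add, mul_add, Pi.add_apply, add_mul]
    rw [integral_add (hd v) (hd w), integral_add (hm g hg.locallyIntegrableOn_right)
      (hm k hk.locallyIntegrableOn_right), hg.integral_eq θ hθ hc hs, hk.integral_eq θ hθ hc hs]
    ring

theorem IsWeakDeriv.const_smul {Ω : Set V} {u g : V → ℝ} {v : V}
    (hg : IsWeakDeriv Ω u g v) (c : ℝ) : IsWeakDeriv Ω u (fun z => c * g z) (c • v) where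
  locallyIntegrableOn_left := hg.locallyIntegrableOn_left
  locallyIntegrableOn_right := by
    intro x hx
    obtain ⟨s, hs, hi⟩ := hg.locallyIntegrableOn_right x hx
    exact ⟨s, hs, hi.const_mul c⟩
  integral_eq θ hθ hc hs := by
    have := hg.integral_eq θ hθ hc hs
    simp only [map_smul, smul_eq_mul, mul_assoc, mul_left_comm _ c]
    rw [integral_const_mul, integral_const_mul, this]
    ring

/-- Weak derivatives on an increasing sequence of open sets glue to a weak derivative on the
union: by uniqueness they agree almost everywhere where several are defined. -/
theorem exists_isWeakDeriv_iUnion [FiniteDimensional ℝ V] [BorelSpace V] {Ω : ℕ → Set V}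
    (hΩ : ∀ k, IsOpen (Ω k)) (hmono : Monotone Ω) {u : V → ℝ} {v : V}
    (h : ∀ k, ∃ g, IsWeakDeriv (Ω k) u g v) : ∃ g, IsWeakDeriv (⋃ k, Ω k) u g v := by
  classical
  choose G hG using h
  have hagree : ∀ᵐ z, ∀ j k, z ∈ Ω j → z ∈ Ω k → G j z = G k z := by
    rw [ae_all_iff]; intro j
    rw [ae_all_iff]; intro k
    rcases le_total j k with hjk | hjk
    · filter_upwards [(hG j).ae_eq_weakDeriv (hΩ j),
        ((hG k).mono (hmono hjk)).ae_eq_weakDeriv (hΩ j)] with z h1 h2 hj _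
      rw [h1 hj, h2 hj]
    · filter_upwards [(hG k).ae_eq_weakDeriv (hΩ k),
        ((hG j).mono (hmono hjk)).ae_eq_weakDeriv (hΩ k)] with z h1 h2 _ hk
      rw [h1 hk, h2 hk]
  let g : V → ℝ := fun z => if hz : ∃ k, z ∈ Ω k then G (Nat.find hz) z else 0
  have hgG : ∀ k, ∀ᵐ z, z ∈ Ω k → G k z = g z := by
    intro k
    filter_upwards [hagree] with z hz hzk
    have hex : ∃ k, z ∈ Ω k := ⟨k, hzk⟩
    simp only [g, dif_pos hex]
    exact hz _ _ hzk (Nat.find_spec hex)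
  have hg : ∀ k, IsWeakDeriv (Ω k) u g v := fun k => (hG k).congr_right (hΩ k) (hgG k)
  have hloc : ∀ f : V → ℝ, (∀ k, LocallyIntegrableOn f (Ω k) volume) →
      LocallyIntegrableOn f (⋃ k, Ω k) volume := by
    intro f hf x hx
    obtain ⟨k, hk⟩ := mem_iUnion.1 hx
    obtain ⟨s, hs, hi⟩ := hf k x hk
    refine ⟨s, ?_, hi⟩
    rw [(hΩ k).nhdsWithin_eq hk] at hs
    exact mem_nhdsWithin_of_mem_nhds hs
  refine ⟨g, hloc u fun k => (hg k).1, hloc g fun k => (hg k).2, ?_⟩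
  intro θ hθ hc hs
  obtain ⟨k, hk⟩ := IsCompact.elim_directed_cover hc Ω hΩ hs hmono.directed_le
  have := (hg k).integral_eq θ hθ hc hk
  rwa [setIntegral_mul_fderiv_eq_integral hs, setIntegral_mul_eq_integral hs,
    ← setIntegral_mul_fderiv_eq_integral hk, ← setIntegral_mul_eq_integral hk]

end WeakDeriv

/-! ### The class `𝓤` in terms of weak derivatives on all of `Q` -/

section MemU

variable {n : ℕ}

theorem isOpen_Q : IsOpen (Q n) := isOpen_univ.prod isOpen_Ioi

theorem isOpen_Qr (r : ℝ) : IsOpen (Qr n r) := Metric.isOpen_ball.prod isOpen_Ioo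

theorem Qr_subset_Q (r : ℝ) : Qr n r ⊆ Q n := prod_mono (subset_univ _) fun _ h => h.1

theorem Qr_mono {r s : ℝ} (hr : 0 ≤ r) (h : r ≤ s) : Qr n r ⊆ Qr n s :=
  prod_mono (Metric.ball_subset_ball h)
    (Ioo_subset_Ioo_right (by gcongr))

theorem iUnion_Qr : ⋃ k : ℕ, Qr n ((k : ℝ) + 1) = Q n := by
  refine Subset.antisymm (iUnion_subset fun k => Qr_subset_Q _) ?_
  rintro ⟨x, t⟩ ⟨-, ht⟩
  have ht : 0 < t := ht
  obtain ⟨k, hk⟩ := exists_nat_gt (max ‖x‖ t)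
  have h1 := (le_max_left _ _).trans_lt hk
  have h2 := (le_max_right _ _).trans_lt hk
  refine mem_iUnion.2 ⟨k, mem_prod.2 ⟨?_, ht, ?_⟩⟩
  · simp only [Metric.mem_ball, dist_zero_right]; linarith
  · change t < ((k : ℝ) + 1) ^ 2
    nlinarith [(Nat.cast_nonneg k : (0 : ℝ) ≤ k)]

theorem exists_subset_Qr {K : Set (SpaceTime n)} (hK : IsCompact K) :
    ∃ r : ℝ, 0 < r ∧ ∀ z ∈ K, z ∈ Q n → z ∈ Qr n r := by
  obtain ⟨R, hR⟩ := hK.isBounded.subset_closedBall 0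
  refine ⟨|R| + 1, by positivity, ?_⟩
  rintro ⟨x, t⟩ hz ⟨-, ht⟩
  have ht : 0 < t := ht
  have h1 := hR hz
  rw [Metric.mem_closedBall, dist_zero_right] at h1
  have h2 : ‖x‖ ≤ R := (norm_fst_le (x, t)).trans h1
  have h3 : |t| ≤ R := (norm_snd_le (x, t)).trans h1
  have h4 := le_abs_self R
  refine mem_prod.2 ⟨?_, ht, ?_⟩
  · simp only [Metric.mem_ball, dist_zero_right]; linarith
  · change t < (|R| + 1) ^ 2
    nlinarith [le_abs_self t, abs_nonneg R]

/-- `f ∈ L²(Q_r⁺)` for every `r > 0`. -/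
def LocL2 (f : SpaceTime n → ℝ) : Prop :=
  ∀ r : ℝ, 0 < r → MemLp f 2 (volume.restrict (Qr n r))

theorem LocL2.locallyIntegrableOn {f : SpaceTime n → ℝ} (hf : LocL2 f) :
    LocallyIntegrableOn f (Q n) volume := by
  intro z hz
  rw [← iUnion_Qr] at hz
  obtain ⟨k, hk⟩ := mem_iUnion.1 hz
  have h1 := (hf ((k : ℝ) + 1) (by positivity)).locallyIntegrable (by norm_num)
  obtain ⟨s, hs, hi⟩ := h1 z
  refine ⟨s ∩ Qr n ((k : ℝ) + 1), mem_nhdsWithin_of_mem_nhds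
    (Filter.inter_mem hs ((isOpen_Qr _).mem_nhds hk)), ?_⟩
  rwa [IntegrableOn, Measure.restrict_restrict' (isOpen_Qr _).measurableSet] at hi

theorem LocL2.congr {f g : SpaceTime n → ℝ} (hf : LocL2 f) (hfg : ∀ᵐ z, z ∈ Q n → f z = g z) :
    LocL2 g := fun r hr =>
  (hf r hr).ae_eq (ae_restrict_of_ae_restrict_of_subset (Qr_subset_Q r)
    ((ae_restrict_iff' isOpen_Q.measurableSet).2 hfg))

theorem LocL2.add {f g : SpaceTime n → ℝ} (hf : LocL2 f) (hg : LocL2 g) : LocL2 (f + g) :=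
  fun r hr => (hf r hr).add (hg r hr)

theorem LocL2.const_mul {f : SpaceTime n → ℝ} (hf : LocL2 f) (c : ℝ) :
    LocL2 (fun z => c * f z) := fun r hr => (hf r hr).const_mul c

theorem memU_of_isWeakDeriv {u : SpaceTime n → ℝ} (hu : LocL2 u)
    (h : ∀ v, ∃ g, LocL2 g ∧ IsWeakDeriv (Q n) u g v) : MemU n u := fun r hr =>
  ⟨hu r hr, fun v =>
    let ⟨g, hg, hw⟩ := h v
    ⟨g, hg r hr, hw.mono (Qr_subset_Q r)⟩⟩

theorem MemU.locL2 {u : SpaceTime n → ℝ} (h : MemU n u) : LocL2 u := fun r hr => (h r hr).1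

/-- Membership in `𝓤` gives weak derivatives on all of `Q`, not only on each `Q_r⁺`. In particular
`dt` and `dx i` take genuine values, not the default `0`. -/
theorem MemU.isWeakDeriv {u : SpaceTime n → ℝ} (h : MemU n u) (v : SpaceTime n) :
    IsWeakDeriv (Q n) u (weakDeriv (Q n) u v) v := by
  have hex : ∃ g, IsWeakDeriv (⋃ k : ℕ, Qr n ((k : ℝ) + 1)) u g v := by
    refine exists_isWeakDeriv_iUnion (fun k => isOpen_Qr _) (fun j k hjk => ?_) fun k => ?_
    · exact Qr_mono (by positivity) (by gcongr)
    · obtain ⟨g, -, hg⟩ := (h ((k : ℝ) + 1) (by positivity)).2 v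
      exact ⟨g, hg⟩
  rw [iUnion_Qr] at hex
  exact hex.choose_spec.weakDeriv

theorem MemU.locL2_weakDeriv {u : SpaceTime n → ℝ} (h : MemU n u) (v : SpaceTime n) :
    LocL2 (weakDeriv (Q n) u v) := by
  intro r hr
  obtain ⟨g, hg, hw⟩ := (h r hr).2 v
  refine hg.ae_eq ((ae_restrict_iff' (isOpen_Qr r).measurableSet).2 ?_)
  filter_upwards [hw.ae_eq_weakDeriv (isOpen_Qr r),
    ((h.isWeakDeriv v).mono (Qr_subset_Q r)).ae_eq_weakDeriv (isOpen_Qr r)] with z h1 h2 hz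
  rw [h1 hz, h2 hz]

end MemU

/-! ### Extension of the initial datum, constant in time -/

section Constant

variable {n : ℕ}

theorem volume_restrict_Q :
    (volume : Measure (SpaceTime n)).restrict (Q n) = volume.prod (volume.restrict (Ioi 0)) := by
  rw [Q, Measure.volume_eq_prod, ← Measure.prod_restrict, Measure.restrict_univ]

theorem locL2_comp_fst {f : EuclideanSpace ℝ (Fin n) → ℝ} (hf : MemLp f 2 volume) :
    LocL2 fun z : SpaceTime n => f z.1 := fun r hr => by
  rw [Qr, Measure.volume_eq_prod, ← Measure.prod_restrict]
  exact (hf.mono_measure Measure.restrict_le_self).comp_fst _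

theorem fderiv_slice_fst {θ : SpaceTime n → ℝ} (hθ : ContDiff ℝ ∞ θ) (t : ℝ)
    (x a : EuclideanSpace ℝ (Fin n)) :
    fderiv ℝ (fun x => θ (x, t)) x a = fderiv ℝ θ (x, t) (a, 0) := by
  have h1 : HasFDerivAt θ (fderiv ℝ θ (x, t)) (x, t) :=
    (hθ.differentiable (by simp) (x, t)).hasFDerivAt
  have h2 := HasFDerivAt.comp (𝕜 := ℝ) (f := fun x => (x, t)) x h1 (hasFDerivAt_prodMk_left x t)
  have h3 : fderiv ℝ (fun x => θ (x, t)) x = _ := h2.fderiv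
  rw [h3]; simp

theorem hasDerivAt_slice_snd {θ : SpaceTime n → ℝ} (hθ : ContDiff ℝ ∞ θ)
    (x : EuclideanSpace ℝ (Fin n)) (t : ℝ) :
    HasDerivAt (fun t => θ (x, t)) (fderiv ℝ θ (x, t) (0, 1)) t := by
  have h1 : HasFDerivAt θ (fderiv ℝ θ (x, t)) (x, t) :=
    (hθ.differentiable (by simp) (x, t)).hasFDerivAt
  exact h1.comp_hasDerivAt t ((hasDerivAt_const t x).prodMk (hasDerivAt_id t))

theorem integrable_comp_fst_mul {f : EuclideanSpace ℝ (Fin n) → ℝ} (hf : MemLp f 2 volume)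
    {θ : SpaceTime n → ℝ} (hθ : Continuous θ) (hc : HasCompactSupport θ) :
    Integrable fun z : SpaceTime n => f z.1 * θ z := by
  obtain ⟨R, hR⟩ := hc.isCompact.isBounded.subset_closedBall 0
  obtain ⟨M, hM⟩ := hc.exists_bound_of_continuous hθ
  have h1 : Integrable ((Metric.closedBall 0 R).indicator f) :=
    (integrable_indicator_iff Metric.isClosed_closedBall.measurableSet).2
      ((hf.locallyIntegrable (by norm_num)).integrableOn_isCompact (isCompact_closedBall 0 R))
  have h2 : Integrable ((Metric.closedBall (0 : ℝ) R).indicator fun _ => (1 : ℝ)) :=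
    (integrable_indicator_iff Metric.isClosed_closedBall.measurableSet).2
      (integrableOn_const (isCompact_closedBall 0 R).measure_lt_top.ne)
  have h3 := (h1.mul_prod h2).mul_bdd (c := M) hθ.aestronglyMeasurable
    (Filter.Eventually.of_forall hM)
  refine h3.congr (Filter.Eventually.of_forall fun z => ?_)
  by_cases hz : z ∈ tsupport θ
  · have hz' := hR hz
    rw [Metric.mem_closedBall, dist_zero_right] at hz'
    have e1 : z.1 ∈ Metric.closedBall (0 : EuclideanSpace ℝ (Fin n)) R := by
      rw [Metric.mem_closedBall, dist_zero_right]; exact (norm_fst_le z).trans hz'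
    have e2 : z.2 ∈ Metric.closedBall (0 : ℝ) R := by
      rw [Metric.mem_closedBall, dist_zero_right]; exact (norm_snd_le z).trans hz'
    simp only [indicator_of_mem e1, indicator_of_mem e2, mul_one]
  · simp only [image_eq_zero_of_notMem_tsupport hz, mul_zero]

/-- The fundamental theorem of calculus on each time line gives the trace formula. -/
theorem integral_comp_fst_mul_dt {f : EuclideanSpace ℝ (Fin n) → ℝ} (hf : MemLp f 2 volume)
    {θ : SpaceTime n → ℝ} (hθ : ContDiff ℝ ∞ θ) (hc : HasCompactSupport θ) :
    ∫ z in Q n, f z.1 * fderiv ℝ θ z (0, 1) = - ∫ x, f x * θ (x, 0) := by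
  have hi := (integrable_comp_fst_mul hf
    ((hθ.continuous_fderiv (by simp)).clm_apply continuous_const)
    (hc.fderiv_apply ℝ ((0, 1) : SpaceTime n))).integrableOn (s := Q n)
  rw [IntegrableOn, volume_restrict_Q] at hi
  rw [volume_restrict_Q, integral_prod _ hi, ← integral_neg]
  refine integral_congr_ae (Filter.Eventually.of_forall fun x => ?_)
  simp only
  rw [integral_const_mul, ← mul_neg]
  congr 1
  have h1 : ContDiff ℝ 1 fun t => θ (x, t) :=
    (hθ.of_le (by simp)).comp (contDiff_const.prodMk contDiff_id)
  have h2 : HasCompactSupport fun t => θ (x, t) :=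
    HasCompactSupport.intro (hc.isCompact.image continuous_snd) fun _ h =>
        image_eq_zero_of_notMem_tsupport fun h' => h ⟨_, h', rfl⟩
  rw [← h2.integral_Ioi_deriv_eq h1 0]
  exact integral_congr_ae (Filter.Eventually.of_forall fun t =>
    (hasDerivAt_slice_snd hθ x t).deriv.symm)

theorem isWeakDeriv_comp_fst_time {f : EuclideanSpace ℝ (Fin n) → ℝ} (hf : MemLp f 2 volume) :
    IsWeakDeriv (Q n) (fun z => f z.1) (fun _ => 0) (0, 1) where
  locallyIntegrableOn_left := (locL2_comp_fst hf).locallyIntegrableOn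
  locallyIntegrableOn_right := locallyIntegrableOn_zero
  integral_eq θ hθ hc hs := by
    have : ∀ x, θ (x, (0 : ℝ)) = 0 := fun x =>
      image_eq_zero_of_notMem_tsupport fun h => lt_irrefl (0 : ℝ) (hs h).2
    simp [integral_comp_fst_mul_dt hf hθ hc, this]

theorem isWeakDeriv_comp_fst_space {f g : EuclideanSpace ℝ (Fin n) → ℝ}
    {a : EuclideanSpace ℝ (Fin n)} (hf : MemLp f 2 volume) (hg : MemLp g 2 volume)
    (h : IsWeakDeriv univ f g a) :
    IsWeakDeriv (Q n) (fun z => f z.1) (fun z => g z.1) (a, 0) where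
  locallyIntegrableOn_left := (locL2_comp_fst hf).locallyIntegrableOn
  locallyIntegrableOn_right := (locL2_comp_fst hg).locallyIntegrableOn
  integral_eq θ hθ hc hs := by
    have hi := (integrable_comp_fst_mul hf
      ((hθ.continuous_fderiv (by simp)).clm_apply continuous_const)
      (hc.fderiv_apply ℝ ((a, 0) : SpaceTime n))).integrableOn (s := Q n)
    have hi' := (integrable_comp_fst_mul hg hθ.continuous hc).integrableOn (s := Q n)
    rw [IntegrableOn, volume_restrict_Q] at hi hi'
    rw [volume_restrict_Q, integral_prod_symm _ hi, integral_prod_symm _ hi', ← integral_neg]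
    refine integral_congr_ae (Filter.Eventually.of_forall fun t => ?_)
    have h1 : ContDiff ℝ ∞ fun x => θ (x, t) := hθ.comp (contDiff_id.prodMk contDiff_const)
    have h2 : HasCompactSupport fun x => θ (x, t) :=
      HasCompactSupport.intro (hc.isCompact.image continuous_fst) fun _ h =>
        image_eq_zero_of_notMem_tsupport fun h' => h ⟨_, h', rfl⟩
    have h3 := h.integral_eq _ h1 h2 (subset_univ _)
    simp only [setIntegral_univ, fderiv_slice_fst hθ] at h3
    exact h3

/-- To have weak derivatives in all directions of space-time it suffices to have them in the
directions of space and in the direction of time. -/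
theorem memU_of_space_time {u : SpaceTime n → ℝ} (hu : LocL2 u)
    (hx : ∀ a, ∃ g, LocL2 g ∧ IsWeakDeriv (Q n) u g (a, 0))
    (ht : ∃ g, LocL2 g ∧ IsWeakDeriv (Q n) u g (0, 1)) : MemU n u := by
  refine memU_of_isWeakDeriv hu ?_
  rintro ⟨a, b⟩
  obtain ⟨g, hg, hgw⟩ := hx a
  obtain ⟨k, hk, hkw⟩ := ht
  refine ⟨g + fun z => b * k z, hg.add (hk.const_mul b), ?_⟩
  have := hgw.add (hkw.const_smul b)
  simpa using this

theorem memU0_comp_fst {u₀ : EuclideanSpace ℝ (Fin n) → ℝ} (hu₀ : MemH1 univ u₀) :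
    MemU0 u₀ fun z : SpaceTime n => u₀ z.1 := by
  have hf : MemLp u₀ 2 volume := by simpa using hu₀.1
  refine ⟨memU_of_space_time (locL2_comp_fst hf) (fun a => ?_)
    ⟨fun _ => 0, fun r _ => MemLp.zero', isWeakDeriv_comp_fst_time hf⟩, fun θ hθ hc => ?_⟩
  · obtain ⟨g, hg, hw⟩ := hu₀.2 a
    rw [Measure.restrict_univ] at hg
    exact ⟨fun z => g z.1, locL2_comp_fst hg, isWeakDeriv_comp_fst_space hf hg hw⟩
  · rw [integral_comp_fst_mul_dt hf hθ hc]
    have h0 : ∫ z in Q n, dt (fun z : SpaceTime n => u₀ z.1) z * θ z = 0 := by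
      rw [← integral_zero (SpaceTime n) ℝ (μ := volume.restrict (Q n))]
      refine setIntegral_congr_ae isOpen_Q.measurableSet ?_
      filter_upwards [(isWeakDeriv_comp_fst_time hf).ae_eq_weakDeriv isOpen_Q] with z hz hzQ
      rw [dt, ← hz hzQ, zero_mul]
    rw [h0]; ring

theorem ae_ae_of_ae_Q {p : SpaceTime n → Prop} (h : ∀ᵐ z, z ∈ Q n → p z) :
    ∀ᵐ t ∂volume.restrict (Ioi (0 : ℝ)), ∀ᵐ x, p (x, t) := by
  have h1 := (ae_restrict_iff' isOpen_Q.measurableSet).2 h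
  rw [volume_restrict_Q] at h1
  exact Measure.ae_ae_of_ae_prod (Measure.measurePreserving_swap.quasiMeasurePreserving.ae h1)

theorem lintegral_exp_weight {ε : ℝ} (hε : 0 < ε) :
    ∫⁻ t in Ioi (0 : ℝ), ENNReal.ofReal (Real.exp (-t / ε) / ε) = 1 := by
  have h1 := integral_exp_mul_Ioi (a := -(1 / ε)) (by simpa using hε) 0
  have h2 : IntegrableOn (fun t => Real.exp (-t / ε) / ε) (Ioi 0) := by
    have := (integrableOn_exp_mul_Ioi (a := -(1 / ε)) (by simpa using hε) 0).div_const ε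
    refine this.congr (Filter.Eventually.of_forall fun t => ?_)
    simp only; congr 2; ring
  rw [← ofReal_integral_eq_lintegral_ofReal h2
    (Filter.Eventually.of_forall fun t => by simp only [Pi.zero_apply]; positivity),
    integral_div]
  have h3 : ∫ t in Ioi (0 : ℝ), Real.exp (-t / ε) = ε := by
    have : ∀ t : ℝ, -t / ε = -(1 / ε) * t := fun t => by ring
    simp_rw [this]
    rw [h1]; simp
  rw [h3, div_self hε.ne', ENNReal.ofReal_one]

/-- The energy of the initial datum, constant in time, does not depend on `ε`. -/
theorem energy_comp_fst {γ ε : ℝ} (hε : 0 < ε) {u₀ : EuclideanSpace ℝ (Fin n) → ℝ}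
    (hf : MemLp u₀ 2 volume) {G : Fin n → EuclideanSpace ℝ (Fin n) → ℝ}
    (hG : ∀ i, MemLp (G i) 2 volume)
    (hw : ∀ i, IsWeakDeriv univ u₀ (G i) (EuclideanSpace.single i 1)) :
    energy γ ε (fun z : SpaceTime n => u₀ z.1)
      = (∫⁻ x, ENNReal.ofReal (∑ i, G i x ^ 2)) + 2 * ∫⁻ x, ENNReal.ofReal (max (u₀ x) 0 ^ γ) := by
  have hall : ∀ᵐ z : SpaceTime n, z ∈ Q n →
      ε * dt (fun z : SpaceTime n => u₀ z.1) z ^ 2 + gradSq (fun z : SpaceTime n => u₀ z.1) z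
        = ∑ i, G i z.1 ^ 2 := by
    have h1 := (isWeakDeriv_comp_fst_time hf).ae_eq_weakDeriv isOpen_Q
    have h2 := ae_all_iff.2 fun i =>
      (isWeakDeriv_comp_fst_space hf (hG i) (hw i)).ae_eq_weakDeriv isOpen_Q
    filter_upwards [h1, h2] with z hz1 hz2 hz
    rw [dt, ← hz1 hz, gradSq]
    simp only [dx, ← hz2 _ hz]
    simp
  rw [energy]
  have : ∀ᵐ t ∂volume.restrict (Ioi (0 : ℝ)), ENNReal.ofReal (Real.exp (-t / ε) / ε) *
      ((∫⁻ x, ENNReal.ofReal (ε * dt (fun z : SpaceTime n => u₀ z.1) (x, t) ^ 2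
          + gradSq (fun z : SpaceTime n => u₀ z.1) (x, t)))
        + 2 * ∫⁻ x, ENNReal.ofReal (max (u₀ x) 0 ^ γ))
      = ENNReal.ofReal (Real.exp (-t / ε) / ε) * ((∫⁻ x, ENNReal.ofReal (∑ i, G i x ^ 2))
        + 2 * ∫⁻ x, ENNReal.ofReal (max (u₀ x) 0 ^ γ)) := by
    filter_upwards [ae_ae_of_ae_Q hall] with t ht
    congr 2
    refine lintegral_congr_ae ?_
    filter_upwards [ht] with x hx
    rw [hx]
  rw [lintegral_congr_ae this, lintegral_mul_const _ (by fun_prop), lintegral_exp_weight hε,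
    one_mul]

/-- The energy of the initial datum is finite. -/
theorem initialEnergy_lt_top {γ : ℝ} (hγ : 1 ≤ γ) {u₀ : EuclideanSpace ℝ (Fin n) → ℝ}
    (hu₀γ : MemLp u₀ (ENNReal.ofReal γ) volume) {G : Fin n → EuclideanSpace ℝ (Fin n) → ℝ}
    (hG : ∀ i, MemLp (G i) 2 volume) :
    (∫⁻ x, ENNReal.ofReal (∑ i, G i x ^ 2)) + 2 * ∫⁻ x, ENNReal.ofReal (max (u₀ x) 0 ^ γ) < ⊤ := by
  have hγ0 : 0 < γ := by linarith
  refine ENNReal.add_lt_top.2 ⟨?_, ENNReal.mul_lt_top (by simp) ?_⟩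
  · have h1 : Integrable fun x => ∑ i, G i x ^ 2 :=
      integrable_finsetSum _ fun i _ => (hG i).integrable_sq
    exact h1.lintegral_lt_top
  · have h1 := hu₀γ.integrable_norm_rpow (by simpa using hγ0) (by simp)
    rw [ENNReal.toReal_ofReal hγ0.le] at h1
    refine lt_of_le_of_lt (lintegral_mono fun x => ENNReal.ofReal_le_ofReal ?_) h1.lintegral_lt_top
    exact Real.rpow_le_rpow (le_max_right _ _)
      (max_le (le_abs_self _) (abs_nonneg _)) hγ0.le

end Constant

/-! ### Changes of the time variable -/

instance (n : ℕ) : (volume : Measure (SpaceTime n)).IsAddHaarMeasure := by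
  rw [Measure.volume_eq_prod]
  infer_instance

/-- A smooth reparametrization `ψ` of time that fixes `0` and has derivative in `[1/2, 2]`. -/
structure TimeChange where
  /-- The underlying homeomorphism of the time axis. -/
  toHomeo : ℝ ≃ₜ ℝ
  contDiff : ContDiff ℝ ∞ toHomeo
  map_zero : toHomeo 0 = 0
  le_deriv : ∀ s, 1 / 2 ≤ deriv toHomeo s
  deriv_le : ∀ s, deriv toHomeo s ≤ 2

namespace TimeChange

variable {n : ℕ} (ψ : TimeChange)

theorem hasDerivAt (s : ℝ) : HasDerivAt ψ.toHomeo (deriv ψ.toHomeo s) s :=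
  (ψ.contDiff.differentiable (by simp) s).hasDerivAt

theorem deriv_pos (s : ℝ) : 0 < deriv ψ.toHomeo s := by linarith [ψ.le_deriv s]

theorem contDiff_deriv : ContDiff ℝ ∞ (deriv ψ.toHomeo) :=
  (contDiff_infty_iff_deriv.1 ψ.contDiff).2

theorem strictMono : StrictMono ψ.toHomeo := strictMono_of_deriv_pos ψ.deriv_pos

theorem pos_iff (s : ℝ) : 0 < ψ.toHomeo s ↔ 0 < s := by
  conv_lhs => rw [← ψ.map_zero]
  exact ψ.strictMono.lt_iff_lt

theorem image_Ioi : ψ.toHomeo '' Ioi 0 = Ioi 0 := by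
  ext t
  constructor
  · rintro ⟨s, hs, rfl⟩
    exact (ψ.pos_iff s).2 hs
  · intro ht
    refine ⟨ψ.toHomeo.symm t, (ψ.pos_iff _).1 ?_, by simp⟩
    simpa using ht

/-- The map `(x, s) ↦ (x, ψ(s))` of space-time. -/
def map (n : ℕ) : SpaceTime n ≃ₜ SpaceTime n := (Homeomorph.refl _).prodCongr ψ.toHomeo

theorem map_apply (z : SpaceTime n) : ψ.map n z = (z.1, ψ.toHomeo z.2) := rfl

theorem map_symm_apply (z : SpaceTime n) : (ψ.map n).symm z = (z.1, ψ.toHomeo.symm z.2) := rfl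

theorem contDiff_map : ContDiff ℝ ∞ (ψ.map n) :=
  contDiff_fst.prodMk (ψ.contDiff.comp contDiff_snd)

theorem hasFDerivAt_map (z : SpaceTime n) :
    HasFDerivAt (ψ.map n) ((ContinuousLinearMap.id ℝ (EuclideanSpace ℝ (Fin n))).prodMap
      (deriv ψ.toHomeo z.2 • ContinuousLinearMap.id ℝ ℝ)) z := by
  have h1 : HasFDerivAt (ψ.map n) _ z := (hasFDerivAt_fst (p := z)).prodMk
    ((ψ.hasDerivAt z.2).hasFDerivAt.comp z (hasFDerivAt_snd (p := z)))
  refine h1.congr_fderiv ?_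
  ext w <;> simp [mul_comm]

theorem det_fderiv_map (z : SpaceTime n) :
    ((ContinuousLinearMap.id ℝ (EuclideanSpace ℝ (Fin n))).prodMap
      (deriv ψ.toHomeo z.2 • ContinuousLinearMap.id ℝ ℝ)).det = deriv ψ.toHomeo z.2 := by
  have := LinearMap.det_prodMap (LinearMap.id : EuclideanSpace ℝ (Fin n) →ₗ[ℝ] _)
    (deriv ψ.toHomeo z.2 • (LinearMap.id : ℝ →ₗ[ℝ] ℝ))
  rw [LinearMap.det_id, LinearMap.det_smul] at this
  rw [ContinuousLinearMap.det]
  refine Eq.trans ?_ (this.trans (by simp))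
  congr 1

theorem mem_Q_map_iff (z : SpaceTime n) : ψ.map n z ∈ Q n ↔ z ∈ Q n := by
  simp only [Q, map_apply, mem_prod, mem_univ, true_and]
  exact ψ.pos_iff z.2

theorem image_Q : ψ.map n '' Q n = Q n := by
  ext z
  constructor
  · rintro ⟨w, hw, rfl⟩
    exact (ψ.mem_Q_map_iff w).2 hw
  · intro hz
    refine ⟨(ψ.map n).symm z, (ψ.mem_Q_map_iff _).1 ?_, by simp⟩
    simpa using hz

theorem setIntegral_Q (f : SpaceTime n → ℝ) :
    ∫ z in Q n, f z = ∫ z in Q n, deriv ψ.toHomeo z.2 * f (ψ.map n z) := by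
  have := integral_image_eq_integral_abs_det_fderiv_smul (volume : Measure (SpaceTime n))
    isOpen_Q.measurableSet (fun z _ => (ψ.hasFDerivAt_map z).hasFDerivWithinAt)
    (ψ.map n).injective.injOn f
  rw [image_Q] at this
  rw [this]
  refine integral_congr_ae (Filter.Eventually.of_forall fun z => ?_)
  simp only [det_fderiv_map, abs_of_pos (ψ.deriv_pos _), smul_eq_mul]

theorem lintegral_Ioi (f : ℝ → ℝ≥0∞) :
    ∫⁻ t in Ioi (0 : ℝ), f t
      = ∫⁻ s in Ioi (0 : ℝ), ENNReal.ofReal (deriv ψ.toHomeo s) * f (ψ.toHomeo s) := by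
  have := lintegral_image_eq_lintegral_abs_deriv_mul measurableSet_Ioi
    (fun s (_ : s ∈ Ioi (0 : ℝ)) => (ψ.hasDerivAt s).hasDerivWithinAt)
    ψ.toHomeo.injective.injOn f
  rw [image_Ioi] at this
  rw [this]
  simp only [abs_of_pos (ψ.deriv_pos _)]

/-- The push-forward of Lebesgue measure under `(x, t) ↦ (x, ψ⁻¹(t))` has density `ψ' ≤ 2`. -/
theorem map_symm_volume_le :
    (volume : Measure (SpaceTime n)).map (ψ.map n).symm ≤ (2 : ℝ≥0∞) • volume := by
  have h1 := map_withDensity_abs_det_fderiv_eq_addHaar (volume : Measure (SpaceTime n))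
    (s := univ) MeasurableSet.univ.nullMeasurableSet
    (fun z _ => (ψ.hasFDerivAt_map z).hasFDerivWithinAt) (ψ.map n).injective.injOn
  rw [image_univ, (ψ.map n).surjective.range_eq, Measure.restrict_univ] at h1
  have h2 := congrArg (Measure.map (ψ.map n).symm) h1
  rw [Measure.map_map (ψ.map n).symm.continuous.measurable (ψ.map n).continuous.measurable,
    (ψ.map n).symm_comp_self, Measure.map_id] at h2
  rw [← h2, ← withDensity_const]
  refine withDensity_mono (Filter.Eventually.of_forall fun z => ?_)
  beta_reduce
  rw [det_fderiv_map, abs_of_pos (ψ.deriv_pos _)]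
  exact (ENNReal.ofReal_le_ofReal (ψ.deriv_le _)).trans (by simp)

theorem locL2_comp_symm {f : SpaceTime n → ℝ} (hf : LocL2 f) :
    LocL2 fun z => f ((ψ.map n).symm z) := fun r hr => by
  obtain ⟨R, hR, hsub⟩ := exists_subset_Qr
    (((isCompact_closedBall (0 : EuclideanSpace ℝ (Fin n)) r).prod
      (isCompact_Icc (a := (0 : ℝ)) (b := r ^ 2))).image (ψ.map n).symm.continuous)
  have hpre : Qr n r ⊆ (ψ.map n).symm ⁻¹' Qr n R := fun z hz => by
    refine hsub _ (mem_image_of_mem _ (prod_mono Metric.ball_subset_closedBall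
      Ioo_subset_Icc_self hz)) ((ψ.mem_Q_map_iff _).1 ?_)
    simpa using Qr_subset_Q r hz
  have hle : (volume.restrict (Qr n r)).map (ψ.map n).symm
      ≤ (2 : ℝ≥0∞) • volume.restrict (Qr n R) :=
    calc (volume.restrict (Qr n r)).map (ψ.map n).symm
        ≤ (volume.restrict ((ψ.map n).symm ⁻¹' Qr n R)).map (ψ.map n).symm :=
          Measure.map_mono (Measure.restrict_mono hpre le_rfl)
            (ψ.map n).symm.continuous.measurable
      _ = (volume.map (ψ.map n).symm).restrict (Qr n R) :=
          ((ψ.map n).symm.toMeasurableEquiv.restrict_map volume (Qr n R)).symm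
      _ ≤ ((2 : ℝ≥0∞) • volume).restrict (Qr n R) :=
          Measure.restrict_mono le_rfl ψ.map_symm_volume_le
      _ = _ := Measure.restrict_smul _ _ _
  exact ((hf R hR).of_measure_le_smul (by simp) hle).comp_of_map
    (ψ.map n).symm.continuous.aemeasurable

/-- The function `(x, t) ↦ u(x, ψ⁻¹(t))`. -/
def reparam (u : SpaceTime n → ℝ) : SpaceTime n → ℝ := fun z => u ((ψ.map n).symm z)

/-- The time derivative of `reparam` by the chain rule, given the time derivative `g` of `u`. -/
noncomputable def reparamDt (g : SpaceTime n → ℝ) : SpaceTime n → ℝ := fun z =>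
  g ((ψ.map n).symm z) / deriv ψ.toHomeo ((ψ.map n).symm z).2

theorem reparam_map (u : SpaceTime n → ℝ) (z : SpaceTime n) :
    ψ.reparam u (ψ.map n z) = u z := by simp [reparam]

theorem reparamDt_map (g : SpaceTime n → ℝ) (z : SpaceTime n) :
    ψ.reparamDt g (ψ.map n z) = g z / deriv ψ.toHomeo z.2 := by simp [reparamDt]

theorem locL2_reparamDt {g : SpaceTime n → ℝ} (hg : LocL2 g) : LocL2 (ψ.reparamDt g) := by
  have hd : Continuous fun z : SpaceTime n => (deriv ψ.toHomeo ((ψ.map n).symm z).2)⁻¹ :=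
    (ψ.contDiff_deriv.continuous.comp
      (continuous_snd.comp (ψ.map n).symm.continuous)).inv₀ fun z => (ψ.deriv_pos _).ne'
  intro r hr
  refine MemLp.of_le_mul (c := 2) (ψ.locL2_comp_symm hg r hr)
    ((ψ.locL2_comp_symm hg r hr).1.mul hd.aestronglyMeasurable)
    (Filter.Eventually.of_forall fun z => ?_)
  have h1 := ψ.le_deriv ((ψ.map n).symm z).2
  rw [reparamDt, norm_div, Real.norm_of_nonneg (ψ.deriv_pos _).le, div_le_iff₀ (ψ.deriv_pos _)]
  nlinarith [norm_nonneg (g ((ψ.map n).symm z))]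

section TestFunction

variable {θ : SpaceTime n → ℝ}

theorem hasCompactSupport_comp (hc : HasCompactSupport θ) :
    HasCompactSupport fun z => θ (ψ.map n z) := hc.comp_homeomorph (ψ.map n)

theorem tsupport_comp_subset (hs : tsupport θ ⊆ Q n) :
    tsupport (fun z => θ (ψ.map n z)) ⊆ Q n := by
  have h1 : tsupport (θ ∘ ψ.map n) ⊆ ψ.map n ⁻¹' tsupport θ :=
    tsupport_comp_subset_preimage θ (ψ.map n).continuous
  exact fun z hz => (ψ.mem_Q_map_iff z).1 (hs (h1 hz))

theorem fderiv_comp_apply (hθ : ContDiff ℝ ∞ θ) (z v : SpaceTime n) :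
    fderiv ℝ (fun z => θ (ψ.map n z)) z v
      = fderiv ℝ θ (ψ.map n z) (v.1, deriv ψ.toHomeo z.2 * v.2) := by
  have h1 : HasFDerivAt (fun z => θ (ψ.map n z)) _ z :=
    ((hθ.differentiable (by simp) _).hasFDerivAt).comp z (ψ.hasFDerivAt_map z)
  rw [h1.fderiv]
  rfl

theorem fderiv_comp_time (hθ : ContDiff ℝ ∞ θ) (z : SpaceTime n) :
    fderiv ℝ (fun z => θ (ψ.map n z)) z (0, 1)
      = deriv ψ.toHomeo z.2 * fderiv ℝ θ (ψ.map n z) (0, 1) := by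
  rw [fderiv_comp_apply ψ hθ, ← smul_eq_mul (deriv ψ.toHomeo z.2) (fderiv ℝ θ _ _), ← map_smul]
  simp

theorem fderiv_deriv_mul_comp_space (hθ : ContDiff ℝ ∞ θ) (z : SpaceTime n)
    (a : EuclideanSpace ℝ (Fin n)) :
    fderiv ℝ (fun z => deriv ψ.toHomeo z.2 * θ (ψ.map n z)) z (a, 0)
      = deriv ψ.toHomeo z.2 * fderiv ℝ θ (ψ.map n z) (a, 0) := by
  have h1 : HasFDerivAt (fun z : SpaceTime n => deriv ψ.toHomeo z.2) _ z :=
    ((ψ.contDiff_deriv.differentiable (by simp) _).hasFDerivAt).comp z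
      (hasFDerivAt_snd (p := z))
  have h2 : DifferentiableAt ℝ (fun z => θ (ψ.map n z)) z :=
    (hθ.comp ψ.contDiff_map).differentiable (by simp) z
  have h3 : HasFDerivAt (fun z => deriv ψ.toHomeo z.2 * θ (ψ.map n z)) _ z :=
    h1.mul h2.hasFDerivAt
  rw [h3.fderiv]
  simp [fderiv_comp_apply ψ hθ]

end TestFunction

theorem isWeakDeriv_reparam_time {u g : SpaceTime n → ℝ} (hu : LocL2 u) (hg : LocL2 g)
    (h : IsWeakDeriv (Q n) u g (0, 1)) :
    IsWeakDeriv (Q n) (ψ.reparam u) (ψ.reparamDt g) (0, 1) where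
  locallyIntegrableOn_left := (ψ.locL2_comp_symm hu).locallyIntegrableOn
  locallyIntegrableOn_right := (ψ.locL2_reparamDt hg).locallyIntegrableOn
  integral_eq θ hθ hc hs := by
    have key := h.integral_eq _ (hθ.comp ψ.contDiff_map) (ψ.hasCompactSupport_comp hc)
      (ψ.tsupport_comp_subset hs)
    rw [ψ.setIntegral_Q, ψ.setIntegral_Q fun z => ψ.reparamDt g z * θ z]
    refine Eq.trans ?_ (key.trans ?_)
    · refine integral_congr_ae (Filter.Eventually.of_forall fun z => ?_)
      have := ψ.fderiv_comp_time hθ z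
      simp only [Function.comp_def, reparam_map] at this ⊢
      rw [this]; ring
    · congr 1
      refine integral_congr_ae (Filter.Eventually.of_forall fun z => ?_)
      have := (ψ.deriv_pos z.2).ne'
      simp only [Function.comp_def, reparamDt_map]
      field_simp

theorem isWeakDeriv_reparam_space {u g : SpaceTime n → ℝ} {a : EuclideanSpace ℝ (Fin n)}
    (hu : LocL2 u) (hg : LocL2 g) (h : IsWeakDeriv (Q n) u g (a, 0)) :
    IsWeakDeriv (Q n) (ψ.reparam u) (ψ.reparam g) (a, 0) where
  locallyIntegrableOn_left := (ψ.locL2_comp_symm hu).locallyIntegrableOn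
  locallyIntegrableOn_right := (ψ.locL2_comp_symm hg).locallyIntegrableOn
  integral_eq θ hθ hc hs := by
    -- the Jacobian depends on time only, so it passes through derivatives in space
    have key := h.integral_eq (fun z => deriv ψ.toHomeo z.2 * θ (ψ.map n z))
      ((ψ.contDiff_deriv.comp contDiff_snd).mul (hθ.comp ψ.contDiff_map))
      (ψ.hasCompactSupport_comp hc).mul_left
      ((tsupport_mul_subset_right).trans (ψ.tsupport_comp_subset hs))
    rw [ψ.setIntegral_Q, ψ.setIntegral_Q fun z => ψ.reparam g z * θ z]
    refine Eq.trans ?_ (key.trans ?_)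
    · refine integral_congr_ae (Filter.Eventually.of_forall fun z => ?_)
      simp only [ψ.fderiv_deriv_mul_comp_space hθ, reparam_map]
      ring
    · congr 1
      refine integral_congr_ae (Filter.Eventually.of_forall fun z => ?_)
      simp only [reparam_map]
      ring

theorem ae_dt_reparam {u : SpaceTime n → ℝ} (hu : MemU n u) :
    ∀ᵐ z, z ∈ Q n → ψ.reparamDt (dt u) z = dt (ψ.reparam u) z :=
  (ψ.isWeakDeriv_reparam_time hu.locL2 (hu.locL2_weakDeriv _)
    (hu.isWeakDeriv _)).ae_eq_weakDeriv isOpen_Q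

theorem ae_gradSq_reparam {u : SpaceTime n → ℝ} (hu : MemU n u) :
    ∀ᵐ z, z ∈ Q n → gradSq u ((ψ.map n).symm z) = gradSq (ψ.reparam u) z := by
  have h := ae_all_iff.2 fun i : Fin n =>
    (ψ.isWeakDeriv_reparam_space hu.locL2 (hu.locL2_weakDeriv _)
      (hu.isWeakDeriv (EuclideanSpace.single i 1, 0))).ae_eq_weakDeriv isOpen_Q
  filter_upwards [h] with z hz hzQ
  simp only [gradSq, dx, ← hz _ hzQ, reparam]

theorem memU0_reparam {u₀ : EuclideanSpace ℝ (Fin n) → ℝ} {u : SpaceTime n → ℝ}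
    (hu : MemU0 u₀ u) : MemU0 u₀ (ψ.reparam u) := by
  refine ⟨memU_of_space_time (ψ.locL2_comp_symm hu.1.locL2) (fun a => ?_) ?_, fun θ hθ hc => ?_⟩
  · exact ⟨_, ψ.locL2_comp_symm (hu.1.locL2_weakDeriv _),
      ψ.isWeakDeriv_reparam_space hu.1.locL2 (hu.1.locL2_weakDeriv _) (hu.1.isWeakDeriv (a, 0))⟩
  · exact ⟨_, ψ.locL2_reparamDt (hu.1.locL2_weakDeriv _),
      ψ.isWeakDeriv_reparam_time hu.1.locL2 (hu.1.locL2_weakDeriv _) (hu.1.isWeakDeriv _)⟩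
  · have key := hu.2 _ (hθ.comp ψ.contDiff_map) (ψ.hasCompactSupport_comp hc)
    have e1 : ∫ z in Q n, dt (ψ.reparam u) z * θ z
        = ∫ z in Q n, ψ.reparamDt (dt u) z * θ z := by
      refine setIntegral_congr_ae isOpen_Q.measurableSet ?_
      filter_upwards [ψ.ae_dt_reparam hu.1] with z hz hzQ
      rw [hz hzQ]
    rw [e1, ψ.setIntegral_Q, ψ.setIntegral_Q fun z => ψ.reparamDt (dt u) z * θ z]
    refine Eq.trans ?_ (key.trans ?_)
    · refine integral_congr_ae (Filter.Eventually.of_forall fun z => ?_)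
      have := ψ.fderiv_comp_time hθ z
      simp only [Function.comp_def, reparam_map] at this ⊢
      rw [this]; ring
    · congr 2
      · refine integral_congr_ae (Filter.Eventually.of_forall fun z => ?_)
        have := (ψ.deriv_pos z.2).ne'
        simp only [Function.comp_def, reparamDt_map]
        field_simp
      · simp [map_apply, ψ.map_zero]

end TimeChange

/-! ### Inner variations in one variable -/

/-- Fubini on the triangle `0 < τ ≤ s`: a primitive of `η` moves onto the tails of `q`. -/
theorem integral_mul_primitive_eq {q η : ℝ → ℝ} (hq : IntegrableOn q (Ioi 0))
    (hη : IntegrableOn η (Ioi 0)) :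
    ∫ s in Ioi (0 : ℝ), q s * ∫ τ in Ioc 0 s, η τ
      = ∫ τ in Ioi (0 : ℝ), η τ * ∫ s in Ioi τ, q s := by
  have hint : Integrable (Function.uncurry fun s τ : ℝ => (Ici τ).indicator (fun s => q s * η τ) s)
      ((volume.restrict (Ioi (0 : ℝ))).prod (volume.restrict (Ioi (0 : ℝ)))) := by
    have h := (Integrable.mul_prod hq hη).indicator
      (measurableSet_le measurable_snd measurable_fst : MeasurableSet {z : ℝ × ℝ | z.2 ≤ z.1})
    refine h.congr (Filter.Eventually.of_forall fun z => ?_)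
    simp [Function.uncurry, indicator]
  have hswap := integral_integral_swap hint
  have e1 : ∀ s ∈ Ioi (0 : ℝ), q s * ∫ τ in Ioc 0 s, η τ
      = ∫ τ in Ioi (0 : ℝ), (Ici τ).indicator (fun s => q s * η τ) s := by
    intro s _
    have : ∀ τ : ℝ, (Ici τ).indicator (fun s => q s * η τ) s
        = (Iic s).indicator (fun τ => q s * η τ) τ := fun τ => by simp [indicator]
    simp_rw [this]
    rw [setIntegral_indicator measurableSet_Iic, Ioi_inter_Iic, integral_const_mul]
  have e2 : ∀ τ ∈ Ioi (0 : ℝ), η τ * ∫ s in Ioi τ, q s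
      = ∫ s in Ioi (0 : ℝ), (Ici τ).indicator (fun s => q s * η τ) s := by
    intro τ hτ
    have hτ : 0 < τ := hτ
    rw [setIntegral_indicator measurableSet_Ici,
      inter_eq_right.2 (Ici_subset_Ioi.2 hτ), integral_Ici_eq_integral_Ioi,
      integral_mul_const, mul_comm]
  rw [setIntegral_congr_fun measurableSet_Ioi e1, setIntegral_congr_fun measurableSet_Ioi e2]
  exact hswap

/-- The integrand of the energy of `u(x, ψ⁻¹(t))` for `ψ(s) = s + δ ξ(s)`, `ξ' = η`, after the
change of variables `t = ψ(s)`; `a` is the kinetic and `ρ` the potential part of the energy of `u`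
at time `s`. -/
noncomputable def innerVar (ε : ℝ) (a ρ ξ η : ℝ → ℝ) (δ s : ℝ) : ℝ :=
  Real.exp (-(s + δ * ξ s) / ε) / ε * (a s / (1 + δ * η s) + (1 + δ * η s) * ρ s)

theorem hasDerivAt_innerVar {ε : ℝ} (a ρ ξ η : ℝ → ℝ) (δ s : ℝ) (h : 1 + δ * η s ≠ 0) :
    HasDerivAt (fun δ => innerVar ε a ρ ξ η δ s)
      (Real.exp (-(s + δ * ξ s) / ε) / ε *
        (-(ξ s / ε) * (a s / (1 + δ * η s) + (1 + δ * η s) * ρ s)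
          + (η s * ρ s - a s * η s / (1 + δ * η s) ^ 2))) δ := by
  have h1 : HasDerivAt (fun δ : ℝ => -(s + δ * ξ s) / ε) (-(ξ s) / ε) δ := by
    have := ((((hasDerivAt_id δ).mul_const (ξ s)).const_add s).neg).div_const ε
    simpa using this
  have h2 : HasDerivAt (fun δ : ℝ => 1 + δ * η s) (η s) δ := by
    simpa using ((hasDerivAt_id δ).mul_const (η s)).const_add 1
  have h3 := (h1.exp.div_const ε).mul
    (((hasDerivAt_const δ (a s)).div h2 h).add (h2.mul_const (ρ s)))
  refine h3.congr_deriv ?_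
  simp only [Pi.add_apply, Pi.div_apply]
  ring

/-- The first variation of the energy under inner variations in time vanishes. -/
theorem integral_firstVariation_eq_zero {ε : ℝ} (hε : 0 < ε) {a ρ ξ η : ℝ → ℝ}
    (ha : ∀ s, 0 ≤ a s) (hρ : ∀ s, 0 ≤ ρ s)
    (hia : IntegrableOn (fun s => Real.exp (-s / ε) / ε * a s) (Ioi 0))
    (hiρ : IntegrableOn (fun s => Real.exp (-s / ε) / ε * ρ s) (Ioi 0))
    (hξ : Continuous ξ) (hη : Continuous η) {M N : ℝ} (hM : ∀ s, |η s| ≤ M) (hN : ∀ s, |ξ s| ≤ N)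
    (hmin : ∀ δ : ℝ, |δ| * M ≤ 1 / 2 →
      IntegrableOn (innerVar ε a ρ ξ η δ) (Ioi 0) →
      ∫ s in Ioi (0 : ℝ), innerVar ε a ρ ξ η 0 s ≤ ∫ s in Ioi (0 : ℝ), innerVar ε a ρ ξ η δ s) :
    ∫ s in Ioi (0 : ℝ), Real.exp (-s / ε) / ε *
      (-(ξ s / ε) * (a s + ρ s) + η s * (ρ s - a s)) = 0 := by
  have hM0 : 0 ≤ M := (abs_nonneg _).trans (hM 0)
  have hN0 : 0 ≤ N := (abs_nonneg _).trans (hN 0)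
  -- for `|δ| < d` the derivative `1 + δ η` of the reparametrization stays in `[1/2, 3/2]`
  set d : ℝ := 1 / (2 * (M + 1)) with hd
  have hd0 : 0 < d := by positivity
  have hdM : ∀ δ : ℝ, |δ| < d → |δ| * M ≤ 1 / 2 := fun δ hδ => by
    have : d * (M + 1) = 1 / 2 := by rw [hd]; field_simp
    nlinarith [abs_nonneg δ]
  have hd1 : d ≤ 1 := by
    rw [hd, div_le_one (by positivity)]; linarith
  -- measurability of `a` and `ρ` from that of the weighted functions
  have hmeas : ∀ f : ℝ → ℝ, IntegrableOn (fun s => Real.exp (-s / ε) / ε * f s) (Ioi 0) →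
      AEStronglyMeasurable f (volume.restrict (Ioi 0)) := fun f hf => by
    have h1 : Continuous fun s : ℝ => ε * Real.exp (s / ε) := by fun_prop
    refine (h1.aestronglyMeasurable.mul hf.aestronglyMeasurable).congr
      (Filter.Eventually.of_forall fun s => ?_)
    simp only [Pi.mul_apply]
    rw [neg_div, Real.exp_neg]
    field_simp
  have hma := hmeas a hia
  have hmρ := hmeas ρ hiρ
  have hrange : ∀ δ : ℝ, |δ| < d → ∀ s, 1 / 2 ≤ 1 + δ * η s ∧ 1 + δ * η s ≤ 3 / 2 := by
    intro δ hδ s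
    have h1 : |δ * η s| ≤ 1 / 2 := by
      rw [abs_mul]
      exact (mul_le_mul_of_nonneg_left (hM s) (abs_nonneg _)).trans (hdM δ hδ)
    have := abs_le.1 h1
    constructor <;> linarith [this.1, this.2]
  have hexp : ∀ δ : ℝ, |δ| < d → ∀ s, Real.exp (-(s + δ * ξ s) / ε) / ε
      ≤ Real.exp (N / ε) * (Real.exp (-s / ε) / ε) := by
    intro δ hδ s
    rw [← mul_div_assoc, ← Real.exp_add]
    gcongr
    rw [← add_div]
    gcongr
    have h1 : |δ * ξ s| ≤ N := by
      rw [abs_mul]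
      calc |δ| * |ξ s| ≤ 1 * N :=
            mul_le_mul (hδ.le.trans hd1) (hN s) (abs_nonneg _) zero_le_one
        _ = N := one_mul N
    linarith [(abs_le.1 h1).1]
  have hpot : ∀ δ : ℝ, |δ| < d → ∀ s,
      a s / (1 + δ * η s) + (1 + δ * η s) * ρ s ≤ 2 * (a s + ρ s) := by
    intro δ hδ s
    obtain ⟨h1, h2⟩ := hrange δ hδ s
    have h3 : a s / (1 + δ * η s) ≤ 2 * a s := by
      rw [div_le_iff₀ (by linarith)]
      nlinarith [ha s]
    nlinarith [hρ s]
  have hpot0 : ∀ δ : ℝ, |δ| < d → ∀ s, 0 ≤ a s / (1 + δ * η s) + (1 + δ * η s) * ρ s := by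
    intro δ hδ s
    obtain ⟨h1, h2⟩ := hrange δ hδ s
    have := ha s
    have := hρ s
    have h3 : 0 ≤ 1 + δ * η s := by linarith
    positivity
  have hmv : ∀ δ : ℝ, AEStronglyMeasurable (innerVar ε a ρ ξ η δ) (volume.restrict (Ioi 0)) := by
    intro δ
    have h1 : Continuous fun s => Real.exp (-(s + δ * ξ s) / ε) / ε := by fun_prop
    have h2 : Continuous fun s => 1 + δ * η s := by fun_prop
    have h3 : Measurable fun s => (1 + δ * η s)⁻¹ := h2.measurable.inv
    refine (h1.aestronglyMeasurable.mul ((hma.mul h3.aestronglyMeasurable).add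
      (h2.aestronglyMeasurable.mul hmρ))).congr (Filter.Eventually.of_forall fun s => ?_)
    simp [innerVar, div_eq_mul_inv]
  have hsum : IntegrableOn (fun s => Real.exp (-s / ε) / ε * (a s + ρ s)) (Ioi 0) := by
    refine (hia.add hiρ).congr (Filter.Eventually.of_forall fun s => ?_)
    simp only [Pi.add_apply]; ring
  have hint : ∀ δ : ℝ, |δ| < d → IntegrableOn (innerVar ε a ρ ξ η δ) (Ioi 0) := by
    intro δ hδ
    refine (hsum.const_mul (Real.exp (N / ε) * 2)).mono' (hmv δ)
      (Filter.Eventually.of_forall fun s => ?_)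
    have h0 := hpot0 δ hδ s
    rw [innerVar, Real.norm_of_nonneg (by positivity)]
    calc _ ≤ Real.exp (N / ε) * (Real.exp (-s / ε) / ε) * (2 * (a s + ρ s)) :=
          mul_le_mul (hexp δ hδ s) (hpot δ hδ s) h0 (by positivity)
      _ = _ := by ring
  have h00 : |(0 : ℝ)| < d := by simpa using hd0
  have key := hasDerivAt_integral_of_dominated_loc_of_deriv_le
    (μ := volume.restrict (Ioi (0 : ℝ))) (F := innerVar ε a ρ ξ η) (x₀ := 0)
    (s := Metric.ball 0 d)
    (F' := fun δ s => Real.exp (-(s + δ * ξ s) / ε) / ε *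
        (-(ξ s / ε) * (a s / (1 + δ * η s) + (1 + δ * η s) * ρ s)
          + (η s * ρ s - a s * η s / (1 + δ * η s) ^ 2)))
    (bound := fun s => Real.exp (N / ε) * (2 * (N / ε) + 4 * M)
      * (Real.exp (-s / ε) / ε * (a s + ρ s)))
    (Metric.ball_mem_nhds 0 hd0) (Filter.Eventually.of_forall hmv) (hint 0 h00)
    ?_ ?_ (hsum.const_mul _) ?_
  · have hmin0 : IsLocalMin (fun δ => ∫ s in Ioi (0 : ℝ), innerVar ε a ρ ξ η δ s) 0 := by
      filter_upwards [Metric.ball_mem_nhds (0 : ℝ) hd0] with δ hδ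
      rw [Metric.mem_ball, dist_zero_right, Real.norm_eq_abs] at hδ
      exact hmin δ (hdM δ hδ) (hint δ hδ)
    have h0 := hmin0.hasDerivAt_eq_zero key.2
    refine Eq.trans ?_ h0
    refine integral_congr_ae (Filter.Eventually.of_forall fun s => ?_)
    simp only [zero_mul, add_zero, div_one, one_mul, one_pow]
    ring
  · have h1 : Continuous fun s => Real.exp (-s / ε) / ε := by fun_prop
    have h2 : Continuous fun s => -(ξ s / ε) := by fun_prop
    refine (h1.aestronglyMeasurable.mul ((h2.aestronglyMeasurable.mul (hma.add hmρ)).add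
      ((hη.aestronglyMeasurable.mul hmρ).sub (hma.mul hη.aestronglyMeasurable)))).congr
      (Filter.Eventually.of_forall fun s => ?_)
    simp
  · refine Filter.Eventually.of_forall fun s δ hδ => ?_
    rw [Metric.mem_ball, dist_zero_right, Real.norm_eq_abs] at hδ
    obtain ⟨h1, h2⟩ := hrange δ hδ s
    have has := ha s
    have hρs := hρ s
    have h0 := hpot0 δ hδ s
    have hA : |-(ξ s / ε) * (a s / (1 + δ * η s) + (1 + δ * η s) * ρ s)|
        ≤ N / ε * (2 * (a s + ρ s)) := by
      rw [abs_mul, abs_neg, abs_div, abs_of_pos hε, abs_of_nonneg h0]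
      exact mul_le_mul (by gcongr; exact hN s) (hpot δ hδ s) h0 (by positivity)
    have hB : |η s * ρ s - a s * η s / (1 + δ * η s) ^ 2| ≤ 4 * M * (a s + ρ s) := by
      have e : η s * ρ s - a s * η s / (1 + δ * η s) ^ 2
          = η s * (ρ s - a s / (1 + δ * η s) ^ 2) := by ring
      have h3 : a s / (1 + δ * η s) ^ 2 ≤ 4 * a s := by
        rw [div_le_iff₀ (by positivity)]
        have : 1 / 4 ≤ (1 + δ * η s) ^ 2 := by nlinarith
        nlinarith
      have h4 : 0 ≤ a s / (1 + δ * η s) ^ 2 := by positivity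
      rw [e, abs_mul]
      calc |η s| * |ρ s - a s / (1 + δ * η s) ^ 2| ≤ M * (4 * (a s + ρ s)) := by
            refine mul_le_mul (hM s) ?_ (abs_nonneg _) hM0
            rw [abs_le]; constructor <;> linarith
        _ = _ := by ring
    rw [norm_mul, Real.norm_of_nonneg (by positivity), Real.norm_eq_abs]
    calc _ ≤ Real.exp (N / ε) * (Real.exp (-s / ε) / ε) *
          (N / ε * (2 * (a s + ρ s)) + 4 * M * (a s + ρ s)) :=
          mul_le_mul (hexp δ hδ s) ((abs_add_le _ _).trans (add_le_add hA hB)) (abs_nonneg _)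
            (by positivity)
      _ = _ := by ring
  · refine Filter.Eventually.of_forall fun s δ hδ => ?_
    rw [Metric.mem_ball, dist_zero_right, Real.norm_eq_abs] at hδ
    exact hasDerivAt_innerVar a ρ ξ η δ s (by linarith [(hrange δ hδ s).1])

theorem contDiff_primitive {η : ℝ → ℝ} (hη : ContDiff ℝ ∞ η) :
    ContDiff ℝ ∞ fun s => ∫ τ in (0 : ℝ)..s, η τ := by
  have hd : ∀ s, HasDerivAt (fun s => ∫ τ in (0 : ℝ)..s, η τ) (η s) s := fun s =>
    intervalIntegral.integral_hasDerivAt_right (hη.continuous.intervalIntegrable _ _)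
      (hη.continuous.stronglyMeasurableAtFilter _ _) hη.continuous.continuousAt
  refine contDiff_infty_iff_deriv.2 ⟨fun s => (hd s).differentiableAt, ?_⟩
  rwa [funext fun s => (hd s).deriv]

theorem abs_primitive_le {η : ℝ → ℝ} (hη : Integrable η) (s : ℝ) :
    |∫ τ in (0 : ℝ)..s, η τ| ≤ ∫ τ, |η τ| :=
  intervalIntegral.norm_integral_le_integral_norm_uIoc.trans
    (setIntegral_le_integral hη.norm (Filter.Eventually.of_forall fun _ => norm_nonneg _))

/-- The Euler-Lagrange equation of inner variations in time: almost everywhere the difference of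
potential and kinetic energy equals the weighted energy that remains after time `τ`. -/
theorem ae_potential_sub_kinetic_eq {ε : ℝ} (hε : 0 < ε) {a ρ : ℝ → ℝ}
    (ha : ∀ s, 0 ≤ a s) (hρ : ∀ s, 0 ≤ ρ s)
    (hia : IntegrableOn (fun s => Real.exp (-s / ε) / ε * a s) (Ioi 0))
    (hiρ : IntegrableOn (fun s => Real.exp (-s / ε) / ε * ρ s) (Ioi 0))
    (hmin : ∀ η : ℝ → ℝ, ContDiff ℝ ∞ η → HasCompactSupport η → tsupport η ⊆ Ioi 0 →
      ∀ δ : ℝ, (∀ s, |δ * η s| ≤ 1 / 2) →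
      IntegrableOn (innerVar ε a ρ (fun s => ∫ τ in (0 : ℝ)..s, η τ) η δ) (Ioi 0) →
      ∫ s in Ioi (0 : ℝ), Real.exp (-s / ε) / ε * (a s + ρ s)
        ≤ ∫ s in Ioi (0 : ℝ), innerVar ε a ρ (fun s => ∫ τ in (0 : ℝ)..s, η τ) η δ s) :
    ∀ᵐ τ, τ ∈ Ioi (0 : ℝ) → ρ τ - a τ
      = Real.exp (τ / ε) * ∫ s in Ioi τ, Real.exp (-s / ε) / ε * (a s + ρ s) := by
  set q : ℝ → ℝ := fun s => Real.exp (-s / ε) / ε * (a s + ρ s) with hqdef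
  have hq : IntegrableOn q (Ioi 0) := by
    refine (hia.add hiρ).congr (Filter.Eventually.of_forall fun s => ?_)
    simp only [Pi.add_apply, hqdef]; ring
  have hdiff : IntegrableOn (fun s => Real.exp (-s / ε) / ε * (ρ s - a s)) (Ioi 0) := by
    refine (hiρ.sub hia).congr (Filter.Eventually.of_forall fun s => ?_)
    simp only [Pi.sub_apply]; ring
  -- the tail `∫ s in Ioi τ, q s` is continuous in `τ > 0`
  have hcont : ContinuousOn (fun τ => ∫ s in Ioi τ, q s) (Ioi 0) := by
    have hq' : Integrable ((Ioi (0 : ℝ)).indicator q) :=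
      (integrable_indicator_iff measurableSet_Ioi).2 hq
    have h1 : Continuous fun τ => (∫ s in Ioi (0 : ℝ), (Ioi (0 : ℝ)).indicator q s)
        - ∫ s in (0 : ℝ)..τ, (Ioi (0 : ℝ)).indicator q s :=
      continuous_const.sub
        (intervalIntegral.continuous_primitive (fun _ _ => hq'.intervalIntegrable) 0)
    refine h1.continuousOn.congr fun τ hτ => ?_
    have hτ : 0 < τ := hτ
    have h2 := intervalIntegral.integral_interval_add_Ioi
      (hq'.integrableOn (s := Ioi 0)) (hq'.integrableOn (s := Ioi τ))
    have h3 : ∫ s in Ioi τ, (Ioi (0 : ℝ)).indicator q s = ∫ s in Ioi τ, q s :=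
      setIntegral_congr_fun measurableSet_Ioi fun s (hs : τ < s) =>
        indicator_of_mem (hτ.trans hs : s ∈ Ioi (0 : ℝ)) q
    simp only
    rw [← h3, ← h2]; ring
  have hloc : LocallyIntegrableOn (fun τ => Real.exp (-τ / ε) / ε * (ρ τ - a τ)
      - 1 / ε * ∫ s in Ioi τ, q s) (Ioi 0) volume :=
    hdiff.locallyIntegrableOn.sub
      ((continuousOn_const.mul hcont).locallyIntegrableOn measurableSet_Ioi)
  have key := isOpen_Ioi.ae_eq_zero_of_integral_contDiff_smul_eq_zero hloc fun η hη hc hs => by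
    set ξ : ℝ → ℝ := fun s => ∫ τ in (0 : ℝ)..s, η τ with hξdef
    have hηi : Integrable η := hη.continuous.integrable_of_hasCompactSupport hc
    have hξc : Continuous ξ := (contDiff_primitive hη).continuous
    obtain ⟨M, hM⟩ := hc.exists_bound_of_continuous hη.continuous
    have hM' : ∀ s, |η s| ≤ M := hM
    have hfv := integral_firstVariation_eq_zero hε ha hρ hia hiρ hξc hη.continuous hM'
      (fun s => abs_primitive_le hηi s) fun δ hδ hint => by
        have h0 : ∀ s, innerVar ε a ρ ξ η 0 s = q s := fun s => by simp [innerVar, hqdef]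
        simp_rw [h0]
        refine hmin η hη hc hs δ (fun s => ?_) hint
        rw [abs_mul]
        exact (mul_le_mul_of_nonneg_left (hM' s) (abs_nonneg _)).trans hδ
    have hfub := integral_mul_primitive_eq hq hηi.integrableOn
    have hξeq : ∀ s ∈ Ioi (0 : ℝ), q s * ∫ τ in Ioc 0 s, η τ = q s * ξ s := fun s hs => by
      rw [hξdef]; simp only; rw [intervalIntegral.integral_of_le (le_of_lt hs)]
    rw [setIntegral_congr_fun measurableSet_Ioi hξeq] at hfub
    have hi1 : IntegrableOn (fun s => q s * ξ s) (Ioi 0) := by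
      refine Integrable.mul_bdd (c := ∫ τ, |η τ|) hq hξc.aestronglyMeasurable
        (Filter.Eventually.of_forall fun s => abs_primitive_le hηi s)
    have hi2 : IntegrableOn (fun s => η s * (Real.exp (-s / ε) / ε * (ρ s - a s))) (Ioi 0) :=
      Integrable.bdd_mul (c := M) hdiff hη.continuous.aestronglyMeasurable
        (Filter.Eventually.of_forall hM)
    have hi3 : IntegrableOn (fun τ => η τ * ∫ s in Ioi τ, q s) (Ioi 0) := by
      have := integrableOn_mul_test
        (hcont.locallyIntegrableOn measurableSet_Ioi) hη.continuous hc hs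
      exact this.congr (Filter.Eventually.of_forall fun s => mul_comm _ _)
    have hsplit : ∫ s in Ioi (0 : ℝ), Real.exp (-s / ε) / ε *
        (-(ξ s / ε) * (a s + ρ s) + η s * (ρ s - a s))
        = -(1 / ε) * (∫ s in Ioi (0 : ℝ), q s * ξ s)
          + ∫ s in Ioi (0 : ℝ), η s * (Real.exp (-s / ε) / ε * (ρ s - a s)) := by
      rw [← integral_const_mul, ← integral_add (hi1.const_mul _) hi2]
      refine integral_congr_ae (Filter.Eventually.of_forall fun s => ?_)
      simp only [hqdef]; ring
    have hzero : ∫ s in Ioi (0 : ℝ), η s • (Real.exp (-s / ε) / ε * (ρ s - a s)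
        - 1 / ε * ∫ s in Ioi s, q s) = 0 := by
      have : ∀ s, η s • (Real.exp (-s / ε) / ε * (ρ s - a s) - 1 / ε * ∫ s in Ioi s, q s)
          = η s * (Real.exp (-s / ε) / ε * (ρ s - a s)) - 1 / ε * (η s * ∫ s in Ioi s, q s) :=
        fun s => by rw [smul_eq_mul]; ring
      simp_rw [this]
      rw [integral_sub hi2 (hi3.const_mul _), integral_const_mul, ← hfub]
      linarith
    rw [← hzero]
    refine (setIntegral_eq_integral_of_forall_compl_eq_zero fun s hs' => ?_).symm
    rw [image_eq_zero_of_notMem_tsupport fun h0 => hs' (hs h0), zero_smul]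
  filter_upwards [key] with τ hτ hτ0
  have h1 := sub_eq_zero.1 (hτ hτ0)
  rw [neg_div, Real.exp_neg] at h1
  have h2 := Real.exp_pos (τ / ε)
  field_simp at h1
  linarith

/-- Energy balance up to time `T`: the integrated form of `H' = -2a/ε` for
`H(T) = e^{T/ε} ∫_T^∞ k (a + ρ)`, where `k(s) = e^{-s/ε}/ε`. -/
theorem energy_balance {ε : ℝ} (hε : 0 < ε) {a ρ : ℝ → ℝ}
    (hia : IntegrableOn (fun s => Real.exp (-s / ε) / ε * a s) (Ioi 0))
    (hiρ : IntegrableOn (fun s => Real.exp (-s / ε) / ε * ρ s) (Ioi 0))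
    (hEL : ∀ᵐ τ, τ ∈ Ioi (0 : ℝ) → ρ τ - a τ
      = Real.exp (τ / ε) * ∫ s in Ioi τ, Real.exp (-s / ε) / ε * (a s + ρ s))
    {T : ℝ} (hT : 0 < T) (hiaT : IntegrableOn a (Ioc 0 T)) (hiρT : IntegrableOn ρ (Ioc 0 T)) :
    2 / ε * (∫ s in Ioc 0 T, a s)
      + Real.exp (T / ε) * (∫ s in Ioi T, Real.exp (-s / ε) / ε * (a s + ρ s))
      = ∫ s in Ioi (0 : ℝ), Real.exp (-s / ε) / ε * (a s + ρ s) := by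
  set q : ℝ → ℝ := fun s => Real.exp (-s / ε) / ε * (a s + ρ s) with hqdef
  have hq : IntegrableOn q (Ioi 0) := by
    refine (hia.add hiρ).congr (Filter.Eventually.of_forall fun s => ?_)
    simp only [Pi.add_apply, hqdef]; ring
  have hqT : IntegrableOn q (Ioc 0 T) := hq.mono_set Ioc_subset_Ioi_self
  have hqT' : IntegrableOn q (Ioi T) := hq.mono_set (Ioi_subset_Ioi hT.le)
  have hsplit : ∀ f : ℝ → ℝ, IntegrableOn f (Ioc 0 T) → IntegrableOn f (Ioi T) →
      ∫ s in Ioi (0 : ℝ), f s = (∫ s in Ioc 0 T, f s) + ∫ s in Ioi T, f s := fun f h1 h2 => by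
    rw [← setIntegral_union (Ioc_disjoint_Ioi le_rfl) measurableSet_Ioi h1 h2,
      Ioc_union_Ioi_eq_Ioi hT.le]
  -- Fubini on the triangle with this weight, cut off at `T`, replaces integration by parts in
  -- `∫₀^T (1/ε) e^{τ/ε} ∫_τ^∞ q`.
  set e : ℝ → ℝ := fun τ => Real.exp (τ / ε) / ε with hedef
  have hec : Continuous e := by fun_prop
  have hη : IntegrableOn ((Ioc 0 T).indicator e) (Ioi 0) :=
    ((integrable_indicator_iff measurableSet_Ioc).2 hec.integrableOn_Ioc).integrableOn
  have hfub := integral_mul_primitive_eq hq hη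
  have hprim : ∀ s : ℝ, 0 ≤ s → ∫ τ in Ioc 0 s, e τ = Real.exp (s / ε) - 1 := by
    intro s hs
    rw [← intervalIntegral.integral_of_le hs, intervalIntegral.integral_eq_sub_of_hasDerivAt
      (f := fun τ => Real.exp (τ / ε)) (fun τ _ => ?_) (hec.intervalIntegrable _ _)]
    · simp
    · have := ((hasDerivAt_id τ).div_const ε).exp
      refine this.congr_deriv ?_
      simp only [hedef, id]; ring
  have hL1 : ∀ s ∈ Ioc (0 : ℝ) T, q s * ∫ τ in Ioc 0 s, (Ioc 0 T).indicator e τ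
      = 1 / ε * (a s + ρ s) - q s := fun s hs => by
    rw [setIntegral_indicator measurableSet_Ioc,
      inter_eq_left.2 (Ioc_subset_Ioc_right hs.2), hprim s hs.1.le]
    simp only [hqdef]
    rw [neg_div, Real.exp_neg]
    have := (Real.exp_pos (s / ε)).ne'
    field_simp
  have hL2 : ∀ s ∈ Ioi T, q s * ∫ τ in Ioc 0 s, (Ioc 0 T).indicator e τ
      = q s * (Real.exp (T / ε) - 1) := fun s hs => by
    rw [setIntegral_indicator measurableSet_Ioc,
      inter_eq_right.2 (Ioc_subset_Ioc_right (le_of_lt hs)), hprim T hT.le]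
  have hsumT : IntegrableOn (fun s => 1 / ε * (a s + ρ s)) (Ioc 0 T) :=
    (hiaT.add hiρT).const_mul _
  rw [hsplit _ ((hsumT.sub hqT).congr_fun (fun s hs => (hL1 s hs).symm) measurableSet_Ioc)
      (IntegrableOn.congr_fun (hqT'.mul_const _) (fun s hs => (hL2 s hs).symm) measurableSet_Ioi),
    setIntegral_congr_fun measurableSet_Ioc hL1, setIntegral_congr_fun measurableSet_Ioi hL2,
    integral_sub hsumT hqT, integral_const_mul, integral_mul_const, integral_add hiaT hiρT]
    at hfub
  have hR : ∫ τ in Ioi (0 : ℝ), (Ioc 0 T).indicator e τ * ∫ s in Ioi τ, q s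
      = 1 / ε * ((∫ s in Ioc 0 T, ρ s) - ∫ s in Ioc 0 T, a s) := by
    rw [← integral_sub hiρT hiaT, ← integral_const_mul]
    have : ∀ τ, (Ioc 0 T).indicator e τ * ∫ s in Ioi τ, q s
        = (Ioc 0 T).indicator (fun τ => e τ * ∫ s in Ioi τ, q s) τ := fun τ => by
      by_cases h : τ ∈ Ioc 0 T <;> simp [h]
    simp_rw [this]
    rw [setIntegral_indicator measurableSet_Ioc, inter_eq_right.2 Ioc_subset_Ioi_self]
    refine setIntegral_congr_ae measurableSet_Ioc ?_
    filter_upwards [hEL] with τ hτ hmem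
    rw [hτ hmem.1]
    simp only [hedef]; ring
  rw [hR] at hfub
  have h1 := hsplit q hqT hqT'
  rw [h1]
  have h2 : 2 / ε * (∫ s in Ioc 0 T, a s)
      = 1 / ε * (∫ s in Ioc 0 T, a s) + 1 / ε * ∫ s in Ioc 0 T, a s := by ring
  linarith

/-- Bounds on kinetic and potential energy in terms of the total weighted energy, from the energy
balance and from `ρ = a + H ≤ a + H(0)`. -/
theorem integral_kinetic_le_and_integral_potential_le {ε : ℝ} (hε : 0 < ε) {a ρ : ℝ → ℝ}
    (ha : ∀ s, 0 ≤ a s) (hρ : ∀ s, 0 ≤ ρ s)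
    (hia : IntegrableOn (fun s => Real.exp (-s / ε) / ε * a s) (Ioi 0))
    (hiρ : IntegrableOn (fun s => Real.exp (-s / ε) / ε * ρ s) (Ioi 0))
    (hEL : ∀ᵐ τ, τ ∈ Ioi (0 : ℝ) → ρ τ - a τ
      = Real.exp (τ / ε) * ∫ s in Ioi τ, Real.exp (-s / ε) / ε * (a s + ρ s))
    {J : ℝ} (hJ : ∫ s in Ioi (0 : ℝ), Real.exp (-s / ε) / ε * (a s + ρ s) ≤ J)
    {T : ℝ} (hT : 0 < T) :
    (IntegrableOn a (Ioc 0 T) ∧ ∫ s in Ioc 0 T, a s ≤ ε / 2 * J) ∧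
      (IntegrableOn ρ (Ioc 0 T) ∧ ∫ s in Ioc 0 T, ρ s ≤ ε / 2 * J + T * J) := by
  have hloc : ∀ f : ℝ → ℝ, IntegrableOn (fun s => Real.exp (-s / ε) / ε * f s) (Ioi 0) →
      ∀ T, IntegrableOn f (Ioc 0 T) := fun f hf T => by
    have h1 : ContinuousOn (fun s : ℝ => ε * Real.exp (s / ε)) (Icc 0 T) := by fun_prop
    have h2 : IntegrableOn (fun s => Real.exp (-s / ε) / ε * f s) (Icc 0 T) :=
      (integrableOn_Icc_iff_integrableOn_Ioc enorm_ne_top).2 (hf.mono_set Ioc_subset_Ioi_self)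
    refine ((h2.continuousOn_mul h1 isCompact_Icc).mono_set Ioc_subset_Icc_self).congr
      (Filter.Eventually.of_forall fun s => ?_)
    simp only
    rw [neg_div, Real.exp_neg]
    have := (Real.exp_pos (s / ε)).ne'
    field_simp
  have hbal := fun {T : ℝ} (hT : 0 < T) =>
    energy_balance hε hia hiρ hEL hT (hloc a hia T) (hloc ρ hiρ T)
  have htail : ∀ T : ℝ, 0 ≤ ∫ s in Ioi T, Real.exp (-s / ε) / ε * (a s + ρ s) := fun T =>
    integral_nonneg fun s => by have := ha s; have := hρ s; simp only [Pi.zero_apply]; positivity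
  have hA : ∀ T : ℝ, 0 ≤ ∫ s in Ioc 0 T, a s := fun T => integral_nonneg ha
  have ha1 : ∫ s in Ioc 0 T, a s ≤ ε / 2 * J := by
    have h1 := hbal hT
    have h2 := mul_nonneg (Real.exp_pos (T / ε)).le (htail T)
    have h3 : 2 / ε * (∫ s in Ioc 0 T, a s) ≤ J := by linarith
    calc ∫ s in Ioc 0 T, a s = ε / 2 * (2 / ε * ∫ s in Ioc 0 T, a s) := by field_simp
      _ ≤ ε / 2 * J := by gcongr
  refine ⟨⟨hloc a hia T, ha1⟩, hloc ρ hiρ T, ?_⟩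
  have hle : ∀ᵐ s ∂volume.restrict (Ioc 0 T), ρ s ≤ a s + J := by
    refine (ae_restrict_iff' measurableSet_Ioc).2 ?_
    filter_upwards [hEL] with s hs hmem
    have h1 := hs hmem.1
    have h2 := hbal hmem.1
    have h3 : 0 ≤ 2 / ε * (∫ s in Ioc 0 s, a s) := mul_nonneg (by positivity) (hA s)
    linarith
  have hci : IntegrableOn (fun _ : ℝ => J) (Ioc 0 T) := integrableOn_const (by simp)
  calc ∫ s in Ioc 0 T, ρ s ≤ ∫ s in Ioc 0 T, (a s + J) :=
        integral_mono_ae (hloc ρ hiρ T) ((hloc a hia T).add hci) hle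
    _ = (∫ s in Ioc 0 T, a s) + T * J := by
        rw [integral_add (hloc a hia T) hci]
        simp [hT.le]
    _ ≤ _ := by linarith

/-! ### Energy estimates for minimizers -/

/-- The perturbation `s ↦ s + δ ∫₀ˢ η` of the identity is an admissible time change. -/
theorem exists_timeChange {η : ℝ → ℝ} (hη : ContDiff ℝ ∞ η) (hc : HasCompactSupport η) {δ : ℝ}
    (hδ : ∀ s, |δ * η s| ≤ 1 / 2) :
    ∃ ψ : TimeChange, ∀ s, ψ.toHomeo s = s + δ * (∫ τ in (0 : ℝ)..s, η τ) ∧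
      deriv ψ.toHomeo s = 1 + δ * η s := by
  set f : ℝ → ℝ := fun s => s + δ * ∫ τ in (0 : ℝ)..s, η τ with hf
  have hfc : ContDiff ℝ ∞ f := contDiff_id.add (contDiff_const.mul (contDiff_primitive hη))
  have hd : ∀ s, HasDerivAt f (1 + δ * η s) s := fun s =>
    (hasDerivAt_id s).add ((intervalIntegral.integral_hasDerivAt_right
      (hη.continuous.intervalIntegrable _ _) (hη.continuous.stronglyMeasurableAtFilter _ _)
      hη.continuous.continuousAt).const_mul δ)
  have hpos : ∀ s, 1 / 2 ≤ 1 + δ * η s := fun s => by linarith [(abs_le.1 (hδ s)).1]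
  have hle : ∀ s, 1 + δ * η s ≤ 2 := fun s => by linarith [(abs_le.1 (hδ s)).2]
  have hmono : StrictMono f := strictMono_of_deriv_pos fun s => by
    rw [(hd s).deriv]; linarith [hpos s]
  have hηi : Integrable η := hη.continuous.integrable_of_hasCompactSupport hc
  have hb : ∀ s, |f s - s| ≤ |δ| * ∫ τ, |η τ| := fun s => by
    simp only [hf, add_sub_cancel_left, abs_mul]
    exact mul_le_mul_of_nonneg_left (abs_primitive_le hηi s) (abs_nonneg _)
  have hsurj : Function.Surjective f := hfc.continuous.surjective
    (Filter.tendsto_atTop_mono (fun s => by simp only [id]; linarith [(abs_le.1 (hb s)).1])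
      (Filter.tendsto_atTop_add_const_right _ (-(|δ| * ∫ τ, |η τ|)) Filter.tendsto_id))
    (Filter.tendsto_atBot_mono (fun s => by simp only [id]; linarith [(abs_le.1 (hb s)).2])
      (Filter.tendsto_atBot_add_const_right _ (|δ| * ∫ τ, |η τ|) Filter.tendsto_id))
  refine ⟨⟨(hmono.orderIsoOfSurjective f hsurj).toHomeomorph, hfc, ?_, fun s => ?_, fun s => ?_⟩,
    fun s => ⟨rfl, (hd s).deriv⟩⟩
  · change f 0 = 0
    simp [hf]
  · exact (hpos s).trans_eq (hd s).deriv.symm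
  · exact (hd s).deriv.trans_le (hle s)

variable {n : ℕ}

/-- The kinetic energy `∫ |∂ₜu|² dx` at time `t`. -/
noncomputable def kinetic (u : SpaceTime n → ℝ) (t : ℝ) : ℝ≥0∞ :=
  ∫⁻ x, ENNReal.ofReal (dt u (x, t) ^ 2)

/-- The potential energy `∫ |∇u|² + 2 u₊^γ dx` at time `t`. -/
noncomputable def potential (γ : ℝ) (u : SpaceTime n → ℝ) (t : ℝ) : ℝ≥0∞ :=
  ∫⁻ x, ENNReal.ofReal (gradSq u (x, t) + 2 * max (u (x, t)) 0 ^ γ)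

theorem gradSq_nonneg (u : SpaceTime n → ℝ) (z : SpaceTime n) : 0 ≤ gradSq u z :=
  Finset.sum_nonneg fun _ _ => sq_nonneg _

section Measurability

variable {u : SpaceTime n → ℝ}

theorem LocL2.aemeasurable (hu : LocL2 u) :
    AEMeasurable u (volume.prod (volume.restrict (Ioi (0 : ℝ)))) := by
  rw [← volume_restrict_Q]
  exact hu.locallyIntegrableOn.aestronglyMeasurable.aemeasurable

theorem MemU.aemeasurable_dt (hu : MemU n u) :
    AEMeasurable (dt u) (volume.prod (volume.restrict (Ioi (0 : ℝ)))) :=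
  (hu.locL2_weakDeriv _).aemeasurable

theorem MemU.aemeasurable_gradSq (hu : MemU n u) :
    AEMeasurable (gradSq u) (volume.prod (volume.restrict (Ioi (0 : ℝ)))) :=
  Finset.aemeasurable_fun_sum _ fun _ _ => ((hu.locL2_weakDeriv _).aemeasurable).pow_const 2

theorem MemU.aemeasurable_kinetic (hu : MemU n u) :
    AEMeasurable (kinetic u) (volume.restrict (Ioi 0)) :=
  (hu.aemeasurable_dt.pow_const 2).ennreal_ofReal.lintegral_prod_left'

theorem MemU.aemeasurable_potential (γ : ℝ) (hu : MemU n u) :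
    AEMeasurable (potential γ u) (volume.restrict (Ioi 0)) :=
  (hu.aemeasurable_gradSq.add (((hu.locL2.aemeasurable.max aemeasurable_const).pow_const
    γ).const_mul 2)).ennreal_ofReal.lintegral_prod_left'

theorem ae_aemeasurable_slice {f : SpaceTime n → ℝ}
    (hf : AEMeasurable f (volume.prod (volume.restrict (Ioi (0 : ℝ))))) :
    ∀ᵐ t ∂volume.restrict (Ioi (0 : ℝ)), AEMeasurable fun x => f (x, t) := by
  filter_upwards [hf.aestronglyMeasurable.prodMk_right] with t ht using ht.aemeasurable

end Measurability

theorem energy_eq_kinetic_potential {γ ε : ℝ} (hε : 0 < ε) {u : SpaceTime n → ℝ}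
    (hu : MemU n u) :
    energy γ ε u = ∫⁻ t in Ioi (0 : ℝ), ENNReal.ofReal (Real.exp (-t / ε) / ε) *
      (ENNReal.ofReal ε * kinetic u t + potential γ u t) := by
  refine lintegral_congr_ae ?_
  filter_upwards [ae_aemeasurable_slice hu.aemeasurable_dt,
    ae_aemeasurable_slice hu.aemeasurable_gradSq] with t h1 h2
  congr 1
  have e1 : ∀ x, ENNReal.ofReal (ε * dt u (x, t) ^ 2 + gradSq u (x, t))
      = ENNReal.ofReal ε * ENNReal.ofReal (dt u (x, t) ^ 2) + ENNReal.ofReal (gradSq u (x, t)) :=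
    fun x => by
      rw [ENNReal.ofReal_add (by positivity) (gradSq_nonneg u _), ENNReal.ofReal_mul hε.le]
  have e2 : ∀ x, ENNReal.ofReal (gradSq u (x, t) + 2 * max (u (x, t)) 0 ^ γ)
      = ENNReal.ofReal (gradSq u (x, t)) + 2 * ENNReal.ofReal (max (u (x, t)) 0 ^ γ) := fun x => by
    have h0 : 0 ≤ max (u (x, t)) 0 ^ γ := Real.rpow_nonneg (le_max_right _ _) _
    rw [ENNReal.ofReal_add (gradSq_nonneg u _) (by positivity), ENNReal.ofReal_mul (by norm_num),
      ENNReal.ofReal_ofNat]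
  rw [kinetic, potential]
  simp_rw [e1, e2]
  rw [lintegral_add_left' ((h1.pow_const 2).ennreal_ofReal.const_mul _),
    lintegral_const_mul' _ _ ENNReal.ofReal_ne_top, lintegral_add_left' h2.ennreal_ofReal,
    lintegral_const_mul' _ _ (by simp), add_assoc]

/-- The energy of `u(x, ψ⁻¹(t))` after the change of variables `t = ψ(s)`. -/
theorem energy_reparam {γ ε : ℝ} (hε : 0 < ε) (ψ : TimeChange) {u : SpaceTime n → ℝ}
    (hu : MemU n u) (hw : MemU n (ψ.reparam u)) :
    energy γ ε (ψ.reparam u) = ∫⁻ s in Ioi (0 : ℝ), ENNReal.ofReal (deriv ψ.toHomeo s) *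
      (ENNReal.ofReal (Real.exp (-ψ.toHomeo s / ε) / ε) *
        (ENNReal.ofReal ε * (ENNReal.ofReal (1 / deriv ψ.toHomeo s ^ 2) * kinetic u s)
          + potential γ u s)) := by
  rw [energy_eq_kinetic_potential hε hw]
  have hae : ∀ᵐ t ∂volume.restrict (Ioi (0 : ℝ)),
      ENNReal.ofReal (Real.exp (-t / ε) / ε) *
        (ENNReal.ofReal ε * kinetic (ψ.reparam u) t + potential γ (ψ.reparam u) t)
      = ENNReal.ofReal (Real.exp (-t / ε) / ε) *
        (ENNReal.ofReal ε * (ENNReal.ofReal (1 / deriv ψ.toHomeo (ψ.toHomeo.symm t) ^ 2)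
          * kinetic u (ψ.toHomeo.symm t)) + potential γ u (ψ.toHomeo.symm t)) := by
    filter_upwards [ae_ae_of_ae_Q (ψ.ae_dt_reparam hu),
      ae_ae_of_ae_Q (ψ.ae_gradSq_reparam hu)] with t h1 h2
    have hk : kinetic (ψ.reparam u) t = ENNReal.ofReal (1 / deriv ψ.toHomeo
        (ψ.toHomeo.symm t) ^ 2) * kinetic u (ψ.toHomeo.symm t) := by
      rw [kinetic, kinetic, ← lintegral_const_mul' _ _ ENNReal.ofReal_ne_top]
      refine lintegral_congr_ae ?_
      filter_upwards [h1] with x hx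
      rw [← hx, ← ENNReal.ofReal_mul (by positivity)]
      congr 1
      simp only [TimeChange.reparamDt, TimeChange.map_symm_apply]
      ring
    have hp : potential γ (ψ.reparam u) t = potential γ u (ψ.toHomeo.symm t) := by
      rw [potential, potential]
      refine lintegral_congr_ae ?_
      filter_upwards [h2] with x hx
      rw [← hx]
      simp only [TimeChange.reparam, TimeChange.map_symm_apply]
    rw [hk, hp]
  rw [lintegral_congr_ae hae, ψ.lintegral_Ioi]
  simp only [Homeomorph.symm_apply_apply]

/-- Bounds on the kinetic and potential energies of a minimizer up to time `T`, given an upper bound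
`J` for its weighted energy. -/
theorem IsMinimizer.lintegral_kinetic_potential_le {γ ε : ℝ} (hε : 0 < ε)
    {u₀ : EuclideanSpace ℝ (Fin n) → ℝ} {u : SpaceTime n → ℝ} (hu : IsMinimizer γ ε u₀ u)
    {J : ℝ} (hJ0 : 0 ≤ J) (hJ : energy γ ε u ≤ ENNReal.ofReal J) {T : ℝ} (hT : 0 < T) :
    (∫⁻ t in Ioc (0 : ℝ) T, kinetic u t) ≤ ENNReal.ofReal (J / 2) ∧
      (∫⁻ t in Ioc (0 : ℝ) T, potential γ u t) ≤ ENNReal.ofReal (ε / 2 * J + T * J) := by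
  have hE := energy_eq_kinetic_potential (γ := γ) hε hu.1.1
  have hmk := hu.1.1.aemeasurable_kinetic
  have hmp := hu.1.1.aemeasurable_potential γ
  have hwc : Continuous fun t : ℝ => Real.exp (-t / ε) / ε := by fun_prop
  have hwpos : ∀ t : ℝ, 0 < Real.exp (-t / ε) / ε := fun t => by positivity
  -- finiteness for almost every `t` lets `toReal` below lose nothing
  have hfin : ∀ᵐ t ∂volume.restrict (Ioi (0 : ℝ)), kinetic u t ≠ ⊤ ∧ potential γ u t ≠ ⊤ := by
    have h1 := ae_lt_top' (hwc.measurable.aemeasurable.ennreal_ofReal.mul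
      ((hmk.const_mul (ENNReal.ofReal ε)).add hmp))
      (hE.symm.trans_lt (hJ.trans_lt ENNReal.ofReal_lt_top)).ne
    filter_upwards [h1] with t ht
    have h2 := ENNReal.lt_top_of_mul_ne_top_right ht.ne
      (ENNReal.ofReal_pos.2 (hwpos t)).ne'
    obtain ⟨h3, h4⟩ := ENNReal.add_lt_top.1 h2
    exact ⟨(ENNReal.lt_top_of_mul_ne_top_right h3.ne (ENNReal.ofReal_pos.2 hε).ne').ne, h4.ne⟩
  set a : ℝ → ℝ := fun t => ε * (kinetic u t).toReal with hadef
  set ρ : ℝ → ℝ := fun t => (potential γ u t).toReal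
  have ha : ∀ t, 0 ≤ a t := fun t => by positivity
  have hρ : ∀ t, 0 ≤ ρ t := fun t => ENNReal.toReal_nonneg
  have hka : ∀ t, kinetic u t ≠ ⊤ → ENNReal.ofReal ε * kinetic u t = ENNReal.ofReal (a t) :=
    fun t ht => by rw [hadef, ENNReal.ofReal_mul hε.le, ENNReal.ofReal_toReal ht]
  have hpρ : ∀ t, potential γ u t ≠ ⊤ → potential γ u t = ENNReal.ofReal (ρ t) :=
    fun t ht => (ENNReal.ofReal_toReal ht).symm
  have hE' : energy γ ε u
      = ∫⁻ t in Ioi (0 : ℝ), ENNReal.ofReal (Real.exp (-t / ε) / ε * (a t + ρ t)) := by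
    rw [hE]
    refine lintegral_congr_ae ?_
    filter_upwards [hfin] with t ht
    rw [hka t ht.1, hpρ t ht.2, ← ENNReal.ofReal_add (ha t) (hρ t),
      ← ENNReal.ofReal_mul (hwpos t).le]
  have hma : AEStronglyMeasurable a (volume.restrict (Ioi 0)) :=
    (hmk.ennreal_toReal.const_mul ε).aestronglyMeasurable
  have hmρ : AEStronglyMeasurable ρ (volume.restrict (Ioi 0)) :=
    hmp.ennreal_toReal.aestronglyMeasurable
  have hsum0 : ∀ t, 0 ≤ Real.exp (-t / ε) / ε * (a t + ρ t) := fun t =>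
    mul_nonneg (hwpos t).le (add_nonneg (ha t) (hρ t))
  have hsum : IntegrableOn (fun t => Real.exp (-t / ε) / ε * (a t + ρ t)) (Ioi 0) := by
    refine ⟨hwc.aestronglyMeasurable.mul (hma.add hmρ), ?_⟩
    rw [hasFiniteIntegral_iff_ofReal (Filter.Eventually.of_forall hsum0), ← hE']
    exact hJ.trans_lt ENNReal.ofReal_lt_top
  have hia : IntegrableOn (fun t => Real.exp (-t / ε) / ε * a t) (Ioi 0) :=
    hsum.mono' (hwc.aestronglyMeasurable.mul hma) (Filter.Eventually.of_forall fun t => by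
      rw [Real.norm_of_nonneg (mul_nonneg (hwpos t).le (ha t))]
      exact mul_le_mul_of_nonneg_left (by linarith [hρ t]) (hwpos t).le)
  have hiρ : IntegrableOn (fun t => Real.exp (-t / ε) / ε * ρ t) (Ioi 0) :=
    hsum.mono' (hwc.aestronglyMeasurable.mul hmρ) (Filter.Eventually.of_forall fun t => by
      rw [Real.norm_of_nonneg (mul_nonneg (hwpos t).le (hρ t))]
      exact mul_le_mul_of_nonneg_left (by linarith [ha t]) (hwpos t).le)
  have hEr : energy γ ε u
      = ENNReal.ofReal (∫ t in Ioi (0 : ℝ), Real.exp (-t / ε) / ε * (a t + ρ t)) := by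
    rw [hE', ofReal_integral_eq_lintegral_ofReal hsum (Filter.Eventually.of_forall hsum0)]
  have hJr : ∫ t in Ioi (0 : ℝ), Real.exp (-t / ε) / ε * (a t + ρ t) ≤ J := by
    rwa [hEr, ENNReal.ofReal_le_ofReal_iff hJ0] at hJ
  have hEL := ae_potential_sub_kinetic_eq hε ha hρ hia hiρ fun η hη hc _ δ hδ hint => by
    obtain ⟨ψ, hψ⟩ := exists_timeChange hη hc hδ
    set ξ : ℝ → ℝ := fun s => ∫ τ in (0 : ℝ)..s, η τ with hξ
    have hw := ψ.memU0_reparam hu.1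
    have h1 := hu.2 _ hw
    have hpos : ∀ s, 0 < 1 + δ * η s := fun s => by linarith [(abs_le.1 (hδ s)).1]
    have hiv : ∀ s, 0 ≤ innerVar ε a ρ ξ η δ s := fun s => by
      have := (hpos s).le
      have := ha s
      have := hρ s
      rw [innerVar]; positivity
    have h2 : energy γ ε (ψ.reparam u)
        = ∫⁻ s in Ioi (0 : ℝ), ENNReal.ofReal (innerVar ε a ρ ξ η δ s) := by
      rw [energy_reparam hε ψ hu.1.1 hw.1]
      refine lintegral_congr_ae ?_
      filter_upwards [hfin] with s hs
      have hp := hpos s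
      rw [mul_left_comm (ENNReal.ofReal ε), hka s hs.1, hpρ s hs.2, (hψ s).1, (hψ s).2,
        ← ENNReal.ofReal_mul (by positivity),
        ← ENNReal.ofReal_add (mul_nonneg (by positivity) (ha s)) (hρ s),
        ← ENNReal.ofReal_mul (by positivity), ← ENNReal.ofReal_mul hp.le]
      congr 1
      simp only [innerVar, hξ]
      have := hp.ne'
      field_simp
    rw [hEr, h2, ← ofReal_integral_eq_lintegral_ofReal hint (Filter.Eventually.of_forall hiv),
      ENNReal.ofReal_le_ofReal_iff (integral_nonneg hiv)] at h1
    exact h1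
  obtain ⟨⟨hia', hA⟩, hiρ', hR⟩ :=
    integral_kinetic_le_and_integral_potential_le hε ha hρ hia hiρ hEL hJr hT
  have hfinT : ∀ᵐ t ∂volume.restrict (Ioc 0 T), kinetic u t ≠ ⊤ ∧ potential γ u t ≠ ⊤ :=
    ae_restrict_of_ae_restrict_of_subset Ioc_subset_Ioi_self hfin
  constructor
  · have e : ∫⁻ t in Ioc (0 : ℝ) T, kinetic u t
        = ∫⁻ t in Ioc (0 : ℝ) T, ENNReal.ofReal (a t / ε) := by
      refine lintegral_congr_ae ?_
      filter_upwards [hfinT] with t ht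
      rw [hadef]
      simp only
      rw [mul_div_cancel_left₀ _ hε.ne', ENNReal.ofReal_toReal ht.1]
    rw [e, ← ofReal_integral_eq_lintegral_ofReal (hia'.div_const ε)
      (Filter.Eventually.of_forall fun t => div_nonneg (ha t) hε.le)]
    refine ENNReal.ofReal_le_ofReal ?_
    rw [integral_div, div_le_iff₀ hε]
    linarith
  · have e : ∫⁻ t in Ioc (0 : ℝ) T, potential γ u t
        = ∫⁻ t in Ioc (0 : ℝ) T, ENNReal.ofReal (ρ t) := by
      refine lintegral_congr_ae ?_
      filter_upwards [hfinT] with t ht using hpρ t ht.2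
    rw [e, ← ofReal_integral_eq_lintegral_ofReal hiρ' (Filter.Eventually.of_forall hρ)]
    exact ENNReal.ofReal_le_ofReal hR

end EllipticReg

theorem mainTheorem2 (n : ℕ) (hn : 1 ≤ n) (γ : ℝ) (hγ₁ : 1 ≤ γ) (hγ₂ : γ < 2)
    (u₀ : EuclideanSpace ℝ (Fin n) → ℝ) (hu₀ : MemH1 univ u₀)
    (hu₀γ : MemLp u₀ (ENNReal.ofReal γ) volume) (hu₀_nonneg : ∀ᵐ x, 0 ≤ u₀ x) :
    ∃ C : ℝ, 0 < C ∧ ∀ ε : ℝ, 0 < ε → ε < 1 →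
      ∀ u : SpaceTime n → ℝ, IsMinimizer γ ε u₀ u →
        (∫⁻ t in Ioi (0 : ℝ), ∫⁻ x, ENNReal.ofReal (dt u (x, t) ^ 2)) ≤ ENNReal.ofReal C ∧
        ∀ r : ℝ, ε ≤ r →
          (∫⁻ t in Ioc (0 : ℝ) r, ∫⁻ x,
            ENNReal.ofReal (gradSq u (x, t) + 2 * max (u (x, t)) 0 ^ γ))
              ≤ ENNReal.ofReal (C * r) := by
  have hf : MemLp u₀ 2 volume := by simpa using hu₀.1
  choose G hG hw using fun i : Fin n => hu₀.2 (EuclideanSpace.single i 1)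
  simp only [Measure.restrict_univ] at hG
  set E₀ : ℝ≥0∞ := (∫⁻ x, ENNReal.ofReal (∑ i, G i x ^ 2))
    + 2 * ∫⁻ x, ENNReal.ofReal (max (u₀ x) 0 ^ γ) with hE₀
  have hE₀fin : E₀ ≠ ⊤ := (initialEnergy_lt_top hγ₁ hu₀γ hG).ne
  have hJ0 : 0 ≤ E₀.toReal := ENNReal.toReal_nonneg
  -- `3/2 = 1/2 + 1`: a kinetic contribution `ε/2 ≤ r/2` and `r` times the total energy
  refine ⟨3 / 2 * E₀.toReal + 1, by positivity, fun ε hε _ u hu => ?_⟩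
  have hJ : energy γ ε u ≤ ENNReal.ofReal E₀.toReal := by
    rw [ENNReal.ofReal_toReal hE₀fin, hE₀, ← energy_comp_fst hε hf hG hw]
    exact hu.2 _ (memU0_comp_fst hu₀)
  have key := fun {T : ℝ} (hT : 0 < T) => hu.lintegral_kinetic_potential_le hε hJ0 hJ hT
  refine ⟨?_, fun r hr => ?_⟩
  · have hU : Ioi (0 : ℝ) = ⋃ k : ℕ, Ioc (0 : ℝ) ((k : ℝ) + 1) := by
      ext t
      simp only [mem_Ioi, mem_iUnion, mem_Ioc]
      refine ⟨fun ht => ?_, fun ⟨_, h, _⟩ => h⟩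
      obtain ⟨k, hk⟩ := exists_nat_ge t
      exact ⟨k, ht, by linarith⟩
    have hmono : Monotone fun k : ℕ => Ioc (0 : ℝ) ((k : ℝ) + 1) := fun j k hjk =>
      Ioc_subset_Ioc_right (by gcongr)
    rw [hU, setLIntegral_iUnion_of_directed _ hmono.directed_le]
    refine iSup_le fun k => (key (by positivity)).1.trans (ENNReal.ofReal_le_ofReal ?_)
    linarith
  · have hr0 : 0 < r := hε.trans_le hr
    refine (key hr0).2.trans (ENNReal.ofReal_le_ofReal ?_)
    nlinarith [mul_le_mul_of_nonneg_right hr hJ0]
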